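/- Let $c>0$ and $a_0,a_1\in\mathbb R$, and let $$f(x,y,z,w)=\bigl(a_0-x^2-z+c(x-y),\;a_1-y^2-w-c(x-y),\;x,\;y\bigr)$$ be the coupled Hénon map, a diffeomorphism of $\mathbb R^4$. Put $A_0=\frac{a_0+a_1}{2}$, $A_1=\frac{a_0-a_1}{2}$, assume $A_0\ge -1$, and put $$R=1+\sqrt{1+A_0},\qquad W^*=\max\Bigl(\Bigl|\tfrac{2R-A_1}{2(c-R)}\Bigr|,\Bigl|\tfrac{-2R-A_1}{2(c-R)}\Bigr|\Bigr),\qquad Z^*=\sqrt{A_0-(W^*)^2-2R}$$ ($W^*$ and $Z^*$ are used only when $R<c$ and $2R<A_0-(W^*)^2$). Let $\Omega(f)$ be the non-wandering set of $f$ and let $$X=\tfrac{x+y}{2},\quad Y=\tfrac{x-y}{2},\quad Z=\tfrac{z+w}{2},\quad W=\tfrac{z-w}{2}.$$ (B-1) $\Omega(f)\subset V_F:=\{(x,y,z,w): |X|,|Y|,|Z|,|W|\le R\}$. (B-2) Suppose that $$A_1\le R<c,\qquad R<A_0-(W^*)^2-R,\qquad W^*\le R.\tag{1}$$ Then $f$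 shows a binary topological horseshoe on $V_F$, in the following sense. The set $V_F\cap f(V_F)$ is the union of two disjoint connected components $C_0,C_1$. Each $C_i$ is a full component, i.e. it completely crosses $V_F$ in the $(X,Y)$-direction without overhang: the $(Z,W)$-projection of $f^{-1}(C_i)$ is all of $[-R,R]^2$, and for every $q\in f^{-1}(C_i)$ the $f$-image of the set of points of $f^{-1}(C_i)$ with the same $(Z,W)$-coordinates as $q$ is projected bijectively onto $[-R,R]^2$ by $(X,Y)$. In the same way, with $f^{-1}$ in place of $f$ and the roles of $(X,Y)$ and $(Z,W)$ exchanged, $f^{-1}(C_0)$ and $f^{-1}(C_1)$ are full components of $V_F\cap f^{-1}(V_F)$. Finally, $f(\Omega(f))=\Omega(f)$, and $f|_{\Omega(f)}$ is semi-conjugate to the full shift $\sigma$ with two symbols: there is a continuous surjection $\pi:\Omega(f)\to\{0,1\}^{\mathbb Z}$ with $\pi\circ f=\sigma\circ\pi$ and $f^n(p)\in C_{\pi(p)_n}$ for all $p\in\Omega(f)$ and $n\in\mathbb Z$; in particular $\Omega(f)\neq\emptyset$. (B-3) If, in addition to (1), $4+c\le Z^*-W^*$, then $\Omega(f)$ is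 uniformly hyperbolic, i.e. it is a compact invariant set over which $\mathbb R^4$ splits as $E^s\oplus E^u$, $Df$-invariantly, with $E^s$ contracted uniformly exponentially by the iterates of $f$ and $E^u$ by those of $f^{-1}$. The same conclusion already holds if, in addition to (1), only $4\le Z^*-W^*$. -/

import Mathlib

open Set

/-! ### The coupled Hénon map -/

/-- The phase space `ℝ⁴`; the point `(x, y, z, w)` is written `((x, y), (z, w))`. -/
abbrev PhaseSpace : Type := (ℝ × ℝ) × (ℝ × ℝ)

/-- The coupled Hénon map
`f (x, y, z, w) = (a₀ - x² - z + c (x - y), a₁ - y² - w - c (x - y), x, y)`,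
together with its inverse. -/
def coupledHenon (a₀ a₁ c : ℝ) : PhaseSpace ≃ₜ PhaseSpace where
  toFun p := ((a₀ - p.1.1 ^ 2 - p.2.1 + c * (p.1.1 - p.1.2),
    a₁ - p.1.2 ^ 2 - p.2.2 - c * (p.1.1 - p.1.2)), (p.1.1, p.1.2))
  invFun p := ((p.2.1, p.2.2), (a₀ - p.2.1 ^ 2 - p.1.1 + c * (p.2.1 - p.2.2),
    a₁ - p.2.2 ^ 2 - p.1.2 - c * (p.2.1 - p.2.2)))
  left_inv := by
    rintro ⟨⟨x, y⟩, ⟨z, w⟩⟩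
    simp only [Prod.mk.injEq, true_and]
    constructor <;> ring
  right_inv := by
    rintro ⟨⟨x, y⟩, ⟨z, w⟩⟩
    simp only [Prod.mk.injEq, and_true]
    constructor <;> ring
  continuous_toFun := by fun_prop
  continuous_invFun := by fun_prop

/-- The rotated coordinates `(X, Y, Z, W) = ½ (x + y, x - y, z + w, z - w)`. -/
noncomputable def rotatedCoords : PhaseSpace ≃ₜ (ℝ × ℝ) × (ℝ × ℝ) where
  toFun p := (((p.1.1 + p.1.2) / 2, (p.1.1 - p.1.2) / 2),
    ((p.2.1 + p.2.2) / 2, (p.2.1 - p.2.2) / 2))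
  invFun q := ((q.1.1 + q.1.2, q.1.1 - q.1.2), (q.2.1 + q.2.2, q.2.1 - q.2.2))
  left_inv := by
    rintro ⟨⟨x, y⟩, ⟨z, w⟩⟩
    simp only [Prod.mk.injEq]
    refine ⟨⟨?_, ?_⟩, ⟨?_, ?_⟩⟩ <;> ring
  right_inv := by
    rintro ⟨⟨x, y⟩, ⟨z, w⟩⟩
    simp only [Prod.mk.injEq]
    refine ⟨⟨?_, ?_⟩, ⟨?_, ?_⟩⟩ <;> ring
  continuous_toFun := by fun_prop
  continuous_invFun := by fun_prop

/-- The region `V_F` of all `(x, y, z, w)` with `|X|, |Y|, |Z|, |W| ≤ R`. -/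
def boxVF (R : ℝ) : Set PhaseSpace :=
  {p | |(p.1.1 + p.1.2) / 2| ≤ R ∧ |(p.1.1 - p.1.2) / 2| ≤ R ∧
    |(p.2.1 + p.2.2) / 2| ≤ R ∧ |(p.2.1 - p.2.2) / 2| ≤ R}

/-- The square `[-R, R]²`. -/
def square (R : ℝ) : Set (ℝ × ℝ) := Icc (-R) R ×ˢ Icc (-R) R

/-! ### Dynamical notions -/

/-- The non-wandering set: every neighbourhood of the point meets one of its own
forward images `f^n U` with `n ≥ 1`. -/
def nonwanderingSet {M : Type*} [TopologicalSpace M] (f : M → M) : Set M :=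
  {p | ∀ U : Set M, IsOpen U → p ∈ U → ∃ n : ℕ, 0 < n ∧ ((f^[n] '' U) ∩ U).Nonempty}

/-- The shift on bi-infinite sequences of two symbols. -/
def fullShift (s : ℤ → Bool) : ℤ → Bool := fun n => s (n + 1)

/-- In the coordinates `φ : M ≃ₜ E₁ × E₂`, let `Δ` be the rectangle `D₁ × D₂`.
`C` is a *full component* of `Δ ∩ f Δ`: it is a connected component of `Δ ∩ f Δ`, its preimage
`C' = f⁻¹ C` stretches over all of `D₂`, and `f` maps every slice
`C' ∩ (D₁ × {π₂ z})`, `z ∈ C'`, onto a set that crosses `Δ` completely and without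
overhang, that is, a set which `π₁` maps bijectively onto `D₁`. -/
def IsFullComponent {M E₁ E₂ : Type*} [TopologicalSpace M] [TopologicalSpace E₁]
    [TopologicalSpace E₂] (f : M ≃ₜ M) (φ : M ≃ₜ E₁ × E₂) (D₁ : Set E₁) (D₂ : Set E₂)
    (C : Set M) : Prop :=
  (∃ p ∈ φ ⁻¹' (D₁ ×ˢ D₂) ∩ f '' (φ ⁻¹' (D₁ ×ˢ D₂)),
    C = connectedComponentIn (φ ⁻¹' (D₁ ×ˢ D₂) ∩ f '' (φ ⁻¹' (D₁ ×ˢ D₂))) p) ∧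
  (fun q => (φ q).2) '' (f ⁻¹' C) = D₂ ∧
  ∀ z ∈ f ⁻¹' C,
    BijOn (fun q => (φ q).1) (f '' (f ⁻¹' C ∩ φ ⁻¹' (D₁ ×ˢ {(φ z).2}))) D₁

/-- `f` shows a *binary topological horseshoe* on the rectangle `Δ = D₁ × D₂` (in the coordinates
`φ`, with `E₁` the stretched and `E₂` the contracted directions):

* `Δ ∩ f Δ` consists of exactly two disjoint pieces `C₀`, `C₁`, each of which crosses `Δ`
  completely and without lateral overhang in the `E₁`-direction;
* in backward time, the two pieces `f⁻¹ C₀`, `f⁻¹ C₁` of `Δ ∩ f⁻¹ Δ` cross `Δ` in the same way in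
  the `E₂`-direction;
* the non-wandering set is invariant, and `f` on it is semi-conjugate to the full shift with two
  symbols, the semi-conjugacy being the itinerary with respect to the pieces `C₀`, `C₁`. -/
def HasBinaryHorseshoe {M E₁ E₂ : Type*} [TopologicalSpace M] [TopologicalSpace E₁]
    [TopologicalSpace E₂] (f : M ≃ₜ M) (φ : M ≃ₜ E₁ × E₂) (D₁ : Set E₁) (D₂ : Set E₂) : Prop :=
  ∃ C : Bool → Set M,
    Disjoint (C false) (C true) ∧
    φ ⁻¹' (D₁ ×ˢ D₂) ∩ f '' (φ ⁻¹' (D₁ ×ˢ D₂)) = C false ∪ C true ∧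
    (∀ i, IsFullComponent f φ D₁ D₂ (C i)) ∧
    (∀ i, IsFullComponent f.symm (φ.trans (Homeomorph.prodComm E₁ E₂)) D₂ D₁ (f ⁻¹' C i)) ∧
    f '' nonwanderingSet f = nonwanderingSet f ∧
    ∃ π : M → ℤ → Bool,
      ContinuousOn π (nonwanderingSet f) ∧
      π '' nonwanderingSet f = univ ∧
      (∀ p ∈ nonwanderingSet f, π (f p) = fullShift (π p)) ∧
      ∀ p ∈ nonwanderingSet f, ∀ n : ℤ, (f ^ n) p ∈ C (π p n)

/-- The set `Λ` is *uniformly hyperbolic* for the diffeomorphism `f`: it is compact and invariant,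
and over it the tangent space splits into two `Df`-invariant complementary subspaces which are
uniformly exponentially contracted in forward and in backward time, respectively. -/
def IsUniformlyHyperbolic {E : Type*} [NormedAddCommGroup E] [NormedSpace ℝ E]
    (f : E ≃ₜ E) (Λ : Set E) : Prop :=
  ContDiff ℝ 1 f ∧ ContDiff ℝ 1 f.symm ∧ IsCompact Λ ∧ f '' Λ = Λ ∧
  ∃ Es Eu : E → Submodule ℝ E,
    (∀ p ∈ Λ, IsCompl (Es p) (Eu p) ∧
      (Es p).map (fderiv ℝ f p).toLinearMap = Es (f p) ∧
      (Eu p).map (fderiv ℝ f p).toLinearMap = Eu (f p)) ∧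
    ∃ K rate : ℝ, 0 < K ∧ 0 < rate ∧ rate < 1 ∧
      (∀ p ∈ Λ, ∀ n : ℕ, ∀ v ∈ Es p, ‖fderiv ℝ (f^[n]) p v‖ ≤ K * rate ^ n * ‖v‖) ∧
      (∀ p ∈ Λ, ∀ n : ℕ, ∀ v ∈ Eu p, ‖fderiv ℝ (f.symm^[n]) p v‖ ≤ K * rate ^ n * ‖v‖)

/-!
In the rotated coordinates the coupled Hénon map is `(u, v) ↦ (G u - v, u)` with
`G (X, Y) = (A₀ - X² - Y², A₁ + 2 (c - X) Y)`, so its orbits are the sequences `uₙ` in the plane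
with `uₙ₊₁ + uₙ₋₁ = G uₙ`. Exchanging `u` and `v` conjugates the map to its inverse, which
gives every backward statement from the forward one.

*Non-wandering points are in the box.* Since `R` is the larger root of `R² - 2R = A₀`, the open
region `X < -R`, `X < -|Z|` is forward invariant and `X` strictly decreases there, so it contains no
non-wandering point. For a point outside the box, the point itself or its mirror image under the
exchange enters this region after one step.

*The horseshoe.* On the part of the box that stays in the box one has `|Y| ≤ W`, hence
`X² ≥ A₀ - W² - 2R > 0`, and this part splits into the legs `X > 0` and `X < 0`. On each of the two
half squares `G` is a bijection onto the square of half-width `2R`: along a level curve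
`(c - X) Y = k` the function `X² + Y²` is monotone for `X ≥ 0` and convex for `X ≤ 0`. So it has two
continuous inverse branches `B i` (`HorseshoeParams.exists_inverseBranch`). A point of a leg is
determined by its own `(Z, W)` and the `(X, Y)` of its image, both arbitrary in the square; this
gives the full components in both time directions and, the legs being images of a product of two
squares, their connectedness.

There are two expanding directions and no uniform expansion, so the realization of itineraries is
topological. A periodic word `s` is realized by a fixed point of
`v ↦ (n ↦ B (s n) (v (n + 1) + v (n - 1)))` on periodic sequences, which exists by Brouwer's theorem
(`exists_fixedPoint_of_bounded_range`). Periodic points are non-wandering, and compactness of the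
non-wandering set extends this to all bi-infinite words (`exists_itinerary_semiconj`). Brouwer's
theorem itself is deduced, after Milnor and Rogers, from the absence of a `C¹` retraction of the
ball onto the sphere: for a retraction `r` the integral over the ball of the Jacobian determinant of
`x ↦ x + t (r x - x)` is a polynomial in `t`, equal to the volume of the ball for small `t` and to
`0` for `t = 1`.

*Hyperbolicity.* If `4 ≤ Z* - W*`, the derivative of the nonlinearity, a symmetric matrix, expands
the Euclidean norm by a factor `μ > 2` over the non-wandering set
(`expands_henonNonlinearity`). Then the linearized recurrence `vₙ₊₁ + vₙ₋₁ = Aₙ vₙ` preserves the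
cone `‖vₙ₋₁‖ ≤ ‖vₙ‖` and grows in it at least by `μ - 1` per step. The stable space consists of the
vectors with bounded forward orbit; it meets every vertical slice because two-point boundary value
problems for the recurrence are solvable (`IsDelayExpanding.exists_mem_stableSpace`).
-/

/-! ### Brouwer's fixed point theorem -/

/-- Extrapolation from nodes close to `0`: a polynomial of degree at most `n` is determined at `1`
by its values at `n + 1` points of `(0, δ)`. -/
lemma exists_extrapolation_weights (n : ℕ) {δ : ℝ} (hδ : 0 < δ) :
    ∃ t w : ℕ → ℝ, (∀ i, 0 < t i ∧ t i < δ) ∧ ∀ p : Polynomial ℝ, p.natDegree ≤ n →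
      p.eval 1 = ∑ i ∈ Finset.range (n + 1), w i * p.eval (t i) := by
  have hinj : Set.InjOn (fun i : ℕ => δ / ((i : ℝ) + 2)) (Finset.range (n + 1) : Set ℕ) := by
    intro i _ j _ hij
    have hi : (0 : ℝ) < (i : ℝ) + 2 := by positivity
    have hj : (0 : ℝ) < (j : ℝ) + 2 := by positivity
    simp only at hij
    rw [div_eq_div_iff hi.ne' hj.ne'] at hij
    have h := mul_left_cancel₀ hδ.ne' hij
    exact_mod_cast (by linarith : (i : ℝ) = j)
  refine ⟨fun i => δ / ((i : ℝ) + 2),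
    fun i => (Lagrange.basis (Finset.range (n + 1)) (fun i : ℕ => δ / ((i : ℝ) + 2)) i).eval 1,
    fun i => ⟨by positivity, div_lt_self hδ ?_⟩, fun p hp => ?_⟩
  · have : (0 : ℝ) ≤ i := i.cast_nonneg
    linarith
  · have hdeg : p.degree < (Finset.range (n + 1)).card := by
      rw [Finset.card_range]
      exact lt_of_le_of_lt p.degree_le_natDegree (by exact_mod_cast Nat.lt_succ_of_le hp)
    conv_lhs => rw [Lagrange.eq_interpolate hinj hdeg, Lagrange.interpolate_apply]
    simp only [Polynomial.eval_finsetSum, Polynomial.eval_mul, Polynomial.eval_C]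
    exact Finset.sum_congr rfl fun i _ => mul_comm _ _

/-- A map that is Lipschitz on the closed unit ball and vanishes off the open ball is Lipschitz. -/
lemma lipschitzWith_of_closedBall {E : Type*} [NormedAddCommGroup E] [NormedSpace ℝ E]
    {h : E → E} {K : NNReal}
    (hK : LipschitzOnWith K h (Metric.closedBall 0 1)) (h0 : ∀ x, 1 ≤ ‖x‖ → h x = 0) :
    LipschitzWith K h := by
  have key : ∀ x y : E, ‖x‖ ≤ 1 → 1 ≤ ‖y‖ → dist (h x) (h y) ≤ K * dist x y := by
    intro x y hx hy
    obtain ⟨s, hs, hs1⟩ : (1 : ℝ) ∈ (fun s : ℝ => ‖AffineMap.lineMap x y s‖) '' Icc 0 1 :=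
      intermediate_value_Icc zero_le_one
        (continuous_norm.comp AffineMap.lineMap_continuous).continuousOn (by simp [hx, hy])
    simp only at hs1
    set z := AffineMap.lineMap x y s with hz
    have h1 : dist (h x) (h z) ≤ K * dist x z :=
      hK.dist_le_mul x (by simpa using hx) z (by simp [hs1])
    rw [h0 y hy]
    rw [h0 z hs1.ge] at h1
    refine h1.trans (mul_le_mul_of_nonneg_left ?_ K.2)
    rw [hz, dist_left_lineMap, Real.norm_of_nonneg hs.1]
    exact mul_le_of_le_one_left dist_nonneg hs.2
  refine LipschitzWith.of_dist_le_mul fun x y => ?_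
  rcases le_total ‖x‖ 1 with hx | hx <;> rcases le_total ‖y‖ 1 with hy | hy
  · exact hK.dist_le_mul x (by simpa using hx) y (by simpa using hy)
  · exact key x y hx hy
  · rw [dist_comm, dist_comm x]
    exact key y x hy hx
  · rw [h0 x hx, h0 y hy, dist_self]
    positivity

section Brouwer

variable {E : Type*} [NormedAddCommGroup E] [InnerProductSpace ℝ E] [FiniteDimensional ℝ E]

lemma exists_polynomial_det_one_add_smul (A : E →L[ℝ] E) :
    ∃ p : Polynomial ℝ, p.natDegree ≤ Module.finrank ℝ E ∧
      ∀ t : ℝ, p.eval t = (ContinuousLinearMap.id ℝ E + t • A).det := by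
  classical
  let b := Module.finBasis ℝ E
  let M := LinearMap.toMatrix b b A.toLinearMap
  refine ⟨(-M).charpolyRev, ?_, fun t => ?_⟩
  · rw [← Matrix.reverse_charpoly]
    refine (Polynomial.reverse_natDegree_le _).trans ?_
    simp [Matrix.charpoly_natDegree_eq_dim]
  · have h : (ContinuousLinearMap.id ℝ E + t • A).det
        = (LinearMap.toMatrix b b (LinearMap.id + t • A.toLinearMap)).det :=
      (LinearMap.det_toMatrix b _).symm
    rw [h, Matrix.charpolyRev, ← Polynomial.coe_evalRingHom, RingHom.map_det]
    congr 1
    ext i j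
    simp [M, Matrix.one_apply]
    split_ifs <;> simp [mul_comm]

/-- A linear map at operator distance less than `1` from the identity has positive determinant. -/
lemma det_one_add_pos {A : E →L[ℝ] E} (hA : ‖A‖ < 1) :
    0 < (ContinuousLinearMap.id ℝ E + A).det := by
  have hne : ∀ s ∈ Icc (0 : ℝ) 1, (ContinuousLinearMap.id ℝ E + s • A).det ≠ 0 := by
    intro s hs h0
    have hs1 : ‖s • A‖ < 1 := by
      rw [norm_smul, Real.norm_of_nonneg hs.1]
      nlinarith [norm_nonneg A, hs.2]
    obtain ⟨v, hv, hv0⟩ : ∃ v, (ContinuousLinearMap.id ℝ E + s • A) v = 0 ∧ v ≠ 0 := by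
      have := (LinearMap.bot_lt_ker_of_det_eq_zero
        (f := (ContinuousLinearMap.id ℝ E + s • A).toLinearMap) h0)
      obtain ⟨v, hv, hv0⟩ := Submodule.exists_mem_ne_zero_of_ne_bot this.ne'
      exact ⟨v, hv, hv0⟩
    have h1 : v = -((s • A) v) := eq_neg_of_add_eq_zero_left hv
    have h2 : ‖v‖ ≤ ‖s • A‖ * ‖v‖ := by
      conv_lhs => rw [h1, norm_neg]
      exact (s • A).le_opNorm v
    nlinarith [norm_pos_iff.2 hv0]
  have hcont : ContinuousOn (fun s : ℝ => (ContinuousLinearMap.id ℝ E + s • A).det) (Icc 0 1) :=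
    (ContinuousLinearMap.continuous_det.comp (by fun_prop)).continuousOn
  by_contra hneg
  push Not at hneg
  have h0 : (ContinuousLinearMap.id ℝ E + (0 : ℝ) • A).det = 1 := by
    simp [ContinuousLinearMap.det]
  obtain ⟨s, hs, hs0⟩ := intermediate_value_Icc' zero_le_one hcont
    (show (0 : ℝ) ∈ Icc _ _ from ⟨by simpa using hneg, by rw [h0]; exact zero_le_one⟩)
  exact hne s hs hs0

/-- A perturbation of the identity by a contraction `k` supported in the unit ball permutes the
closed unit ball as soon as it maps it into itself. -/
lemma image_closedBall_add_contraction {k : E → E} {K : NNReal} (hK1 : K < 1)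
    (hK : LipschitzWith K k) (h0 : ∀ x, 1 ≤ ‖x‖ → k x = 0)
    (hmaps : ∀ x, ‖x‖ ≤ 1 → ‖x + k x‖ ≤ 1) :
    Function.Injective (fun x => x + k x) ∧
      (fun x => x + k x) '' Metric.closedBall 0 1 = Metric.closedBall 0 1 := by
  refine ⟨fun x y hxy => ?_, Subset.antisymm ?_ ?_⟩
  · have h1 : x - y = k y - k x := by
      simp only at hxy
      rw [sub_eq_sub_iff_add_eq_add, hxy, add_comm]
    have h2 : dist x y ≤ K * dist x y := by
      conv_lhs => rw [dist_eq_norm, h1, ← dist_eq_norm, dist_comm]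
      exact hK.dist_le_mul x y
    have h3 : (K : ℝ) < 1 := by exact_mod_cast hK1
    by_contra hne
    nlinarith [dist_pos.2 hne]
  · rintro _ ⟨x, hx, rfl⟩
    simpa using hmaps x (by simpa using hx)
  · intro y hy
    have hc : ContractingWith K (fun x => y - k x) := by
      refine ⟨hK1, LipschitzWith.of_dist_le_mul fun a b => ?_⟩
      rw [dist_sub_left]
      exact hK.dist_le_mul a b
    have hfix := hc.fixedPoint_isFixedPt
    set x := ContractingWith.fixedPoint _ hc
    have hx : x + k x = y := by
      have h4 : y - k x = x := hfix
      exact (sub_eq_iff_eq_add.1 h4).symm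
    refine ⟨x, ?_, hx⟩
    by_contra hx1
    have hx1' : 1 < ‖x‖ := by simpa using hx1
    rw [h0 x hx1'.le, add_zero] at hx
    rw [hx] at hx1
    exact hx1 hy

/-- There is no continuously differentiable retraction of the closed unit ball onto the unit
sphere. If `r` were one, then `x ↦ x + t (r x - x)` would permute the ball for small `t`, so the
integral of its Jacobian determinant over the ball, a polynomial in `t`, would be the constant
`vol B`; but at `t = 1` this determinant vanishes identically. -/
theorem not_exists_contDiff_retraction {r : E → E} {U : Set E} (hU : IsOpen U)
    (hBU : Metric.closedBall 0 1 ⊆ U) (hr : ContDiffOn ℝ 1 r U)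
    (hfix : ∀ x, ‖x‖ = 1 → r x = x) (hsph : ∀ x, ‖x‖ ≤ 1 → ‖r x‖ = 1) : False := by
  borelize E
  let μ : MeasureTheory.Measure E := MeasureTheory.volume
  let B : Set E := Metric.closedBall 0 1
  have hBc : IsCompact B := isCompact_closedBall 0 1
  have hd : ∀ x ∈ U, HasFDerivAt r (fderiv ℝ r x) x := fun x hx =>
    ((hr.differentiableOn one_ne_zero).differentiableAt (hU.mem_nhds hx)).hasFDerivAt
  have hdc : ContinuousOn (fderiv ℝ r) B := (hr.continuousOn_fderiv_of_isOpen hU le_rfl).mono hBU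
  let A : E → E →L[ℝ] E := fun x => fderiv ℝ r x - ContinuousLinearMap.id ℝ E
  have hAc : ContinuousOn A B := hdc.sub continuousOn_const
  obtain ⟨K₀, hK₀⟩ := hBc.exists_bound_of_continuousOn hAc
  let K : NNReal := ⟨max K₀ 1, le_trans zero_le_one (le_max_right _ _)⟩
  have hK1 : (1 : ℝ) ≤ K := le_max_right _ _
  have hAK : ∀ x ∈ B, ‖A x‖ ≤ K := fun x hx => (hK₀ x hx).trans (le_max_left _ _)
  classical
  let h : E → E := fun x => if ‖x‖ ≤ 1 then r x - x else 0
  have hB : ∀ x, x ∈ B ↔ ‖x‖ ≤ 1 := fun x => by simp [B]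
  have hhB : ∀ x ∈ B, h x = r x - x := fun x hx => if_pos ((hB x).1 hx)
  have hderiv : ∀ x ∈ B, HasFDerivWithinAt h (A x) B x := fun x hx =>
    (((hd x (hBU hx)).hasFDerivWithinAt.sub (hasFDerivWithinAt_id x B)).congr hhB (hhB x hx))
  have hLipB : LipschitzOnWith K h B :=
    (convex_closedBall 0 1).lipschitzOnWith_of_nnnorm_hasFDerivWithin_le hderiv
      fun x hx => hAK x hx
  have h0 : ∀ x, 1 ≤ ‖x‖ → h x = 0 := by
    intro x hx
    rcases hx.eq_or_lt with hx | hx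
    · simp only [h]
      rw [hfix x hx.symm, sub_self, ite_self]
    · exact if_neg (not_le.2 hx)
  have hLip : LipschitzWith K h := lipschitzWith_of_closedBall hLipB h0
  -- for small `t` the Jacobian integral is the volume of the ball
  have hKpos : (0 : ℝ) < K := zero_lt_one.trans_le hK1
  have hvol : ∀ t : ℝ, 0 < t → t < 1 / K →
      ∫ x in B, (ContinuousLinearMap.id ℝ E + t • A x).det ∂μ = μ.real B := by
    intro t ht htK
    have htK' : t * K < 1 := by rwa [lt_div_iff₀ hKpos] at htK
    have ht1 : t ≤ 1 := by nlinarith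
    let k : E → E := fun x => t • h x
    have hk : LipschitzWith (⟨t, ht.le⟩ * K) k := by
      refine LipschitzWith.of_dist_le_mul fun x y => ?_
      simp only [k, dist_smul₀, Real.norm_of_nonneg ht.le]
      refine (mul_le_mul_of_nonneg_left (hLip.dist_le_mul x y) ht.le).trans_eq ?_
      exact (mul_assoc t (K : ℝ) (dist x y)).symm
    have hmaps : ∀ x, ‖x‖ ≤ 1 → ‖x + k x‖ ≤ 1 := by
      intro x hx
      have : x + k x = (1 - t) • x + t • r x := by
        simp only [k, hhB x ((hB x).2 hx)]
        module
      rw [this]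
      refine (norm_add_le _ _).trans ?_
      rw [norm_smul, norm_smul, hsph x hx, Real.norm_of_nonneg ht.le,
        Real.norm_of_nonneg (sub_nonneg.2 ht1)]
      nlinarith
    obtain ⟨hinj, himg⟩ := image_closedBall_add_contraction
      (show (⟨t, ht.le⟩ * K : NNReal) < 1 by rw [← NNReal.coe_lt_coe]; exact htK') hk
      (fun x hx => by simp [k, h0 x hx]) hmaps
    have hder : ∀ x ∈ B, HasFDerivWithinAt (fun x => x + k x)
        (ContinuousLinearMap.id ℝ E + t • A x) B x := fun x hx =>
      (hasFDerivWithinAt_id x B).add ((hderiv x hx).const_smul t)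
    have hcv := MeasureTheory.integral_image_eq_integral_abs_det_fderiv_smul μ
      hBc.measurableSet hder hinj.injOn (fun _ => (1 : ℝ))
    rw [himg] at hcv
    have hone : ∫ _ in B, (1 : ℝ) ∂μ = μ.real B := by simp
    rw [← hone]
    refine Eq.trans ?_ hcv.symm
    refine MeasureTheory.setIntegral_congr_fun hBc.measurableSet fun x hx => ?_
    have hpos : 0 < (ContinuousLinearMap.id ℝ E + t • A x).det := by
      refine det_one_add_pos ?_
      rw [norm_smul, Real.norm_of_nonneg ht.le]
      exact (mul_le_mul_of_nonneg_left (hAK x hx) ht.le).trans_lt htK'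
    simp only [smul_eq_mul, mul_one, abs_of_pos hpos]
  obtain ⟨t, w, ht, hw⟩ := exists_extrapolation_weights (Module.finrank ℝ E)
    (one_div_pos.2 hKpos)
  -- at `t = 1` the determinant vanishes since the image of `r` lies in the sphere
  have hdet1 : ∀ x, ‖x‖ < 1 → (ContinuousLinearMap.id ℝ E + (1 : ℝ) • A x).det = 0 := by
    intro x hx
    have hxU : x ∈ U := hBU (by simpa using hx.le)
    have hid : ContinuousLinearMap.id ℝ E + (1 : ℝ) • A x = fderiv ℝ r x := by
      simp [A]
    rw [hid]
    by_contra hdet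
    have hsurj : Function.Surjective (fderiv ℝ r x) := by
      have hu : IsUnit (LinearMap.det (fderiv ℝ r x).toLinearMap) := isUnit_iff_ne_zero.2 hdet
      exact ((LinearMap.isUnit_iff_isUnit_det _).2 hu |> (Module.End.isUnit_iff _).1).surjective
    obtain ⟨v, hv⟩ := hsurj (r x)
    have hn : HasFDerivAt (fun y => ‖r y‖ ^ 2) (2 • (innerSL ℝ (r x)).comp (fderiv ℝ r x)) x :=
      (hd x hxU).norm_sq
    have hc : (fun y => ‖r y‖ ^ 2) =ᶠ[nhds x] fun _ => (1 : ℝ) := by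
      filter_upwards [(continuous_norm.isOpen_preimage _ isOpen_Iio).mem_nhds hx] with y hy
      rw [hsph y (le_of_lt hy), one_pow]
    have hz := hn.unique ((hasFDerivAt_const (1 : ℝ) x).congr_of_eventuallyEq hc)
    have hz' := congrArg (fun L => L v) hz
    simp [hv, hsph x hx.le] at hz'
  have hint : ∀ t : ℝ, MeasureTheory.IntegrableOn
      (fun x => (ContinuousLinearMap.id ℝ E + t • A x).det) B μ := fun t =>
    (ContinuousLinearMap.continuous_det.comp_continuousOn
      (continuousOn_const.add (hAc.const_smul t))).integrableOn_compact hBc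
  have hone : (1 : ℝ) = ∑ i ∈ Finset.range (Module.finrank ℝ E + 1), w i := by
    simpa using hw 1 (by simp)
  have hsum : ∀ x, (ContinuousLinearMap.id ℝ E + (1 : ℝ) • A x).det
      = ∑ i ∈ Finset.range (Module.finrank ℝ E + 1),
        w i * (ContinuousLinearMap.id ℝ E + t i • A x).det := by
    intro x
    obtain ⟨p, hp, hpe⟩ := exists_polynomial_det_one_add_smul (A x)
    simpa only [hpe] using hw p hp
  have hI : ∫ x in B, (ContinuousLinearMap.id ℝ E + (1 : ℝ) • A x).det ∂μ = μ.real B := by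
    simp_rw [hsum]
    rw [MeasureTheory.integral_finsetSum _ fun i _ => (hint (t i)).const_mul (w i)]
    simp_rw [MeasureTheory.integral_const_mul, hvol _ (ht _).1 (ht _).2]
    rw [← Finset.sum_mul, ← hone, one_mul]
  have hzero : ∫ x in B, (ContinuousLinearMap.id ℝ E + (1 : ℝ) • A x).det ∂μ = 0 := by
    have hcl : IsClosed {x | x ∈ B ∧ (ContinuousLinearMap.id ℝ E + (1 : ℝ) • A x).det = 0} :=
      (ContinuousLinearMap.continuous_det.comp_continuousOn
        (continuousOn_const.add (hAc.const_smul (1 : ℝ)))).preimage_isClosed_of_isClosed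
        hBc.isClosed isClosed_singleton
    have hsub : B ⊆ {x | x ∈ B ∧ (ContinuousLinearMap.id ℝ E + (1 : ℝ) • A x).det = 0} := by
      conv_lhs => rw [show B = closure (Metric.ball 0 1) from (closure_ball 0 one_ne_zero).symm]
      refine closure_minimal (fun x hx => ⟨Metric.ball_subset_closedBall hx, hdet1 x ?_⟩) hcl
      simpa using hx
    rw [MeasureTheory.setIntegral_congr_fun hBc.measurableSet fun x hx => (hsub hx).2]
    simp
  have hpos : 0 < μ.real B :=
    ENNReal.toReal_pos (Metric.measure_closedBall_pos μ 0 one_pos).ne' hBc.measure_lt_top.ne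
  linarith

/-- Brouwer's theorem for continuously differentiable maps: if `f` had no fixed point in the ball,
the point where the ray from `f x` through `x` leaves the ball would define a retraction onto the
sphere. -/
lemma exists_fixedPoint_of_contDiff {f : E → E} (hf : ContDiff ℝ 1 f)
    (hmaps : ∀ x, ‖x‖ ≤ 1 → ‖f x‖ ≤ 1) : ∃ x, ‖x‖ ≤ 1 ∧ f x = x := by
  by_contra! hne
  let u : E → E := fun x => x - f x
  let D : E → ℝ := fun x => inner ℝ x (u x) ^ 2 + ‖u x‖ ^ 2 * (1 - ‖x‖ ^ 2)
  have hu : ContDiff ℝ 1 u := contDiff_id.sub hf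
  have hD : ContDiff ℝ 1 D :=
    ((contDiff_id.inner ℝ hu).pow 2).add
      ((hu.norm_sq ℝ).mul (contDiff_const.sub (contDiff_id.norm_sq ℝ)))
  let U : Set E := {x | u x ≠ 0 ∧ 0 < D x}
  have hU : IsOpen U := (isOpen_ne_fun hu.continuous continuous_const).inter
    (isOpen_lt continuous_const hD.continuous)
  have hu0 : ∀ x, ‖x‖ ≤ 1 → u x ≠ 0 := fun x hx h => hne x hx (sub_eq_zero.1 h).symm
  have hin : ∀ x, ‖x‖ = 1 → 0 < inner ℝ x (u x) := by
    intro x hx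
    have h1 : ‖f x‖ ≤ 1 := hmaps x hx.le
    have h2 : 0 < ‖u x‖ ^ 2 := by
      have := norm_pos_iff.2 (hu0 x hx.le)
      positivity
    have h3 : ‖u x‖ ^ 2 = ‖x‖ ^ 2 - 2 * inner ℝ x (f x) + ‖f x‖ ^ 2 := norm_sub_sq_real x (f x)
    have h4 : inner ℝ x (u x) = ‖x‖ ^ 2 - inner ℝ x (f x) := by
      simp only [u, inner_sub_right, real_inner_self_eq_norm_sq]
    rw [hx] at h3 h4
    nlinarith [norm_nonneg (f x)]
  have hBU : Metric.closedBall 0 1 ⊆ U := by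
    intro x hx
    have hx1 : ‖x‖ ≤ 1 := by simpa using hx
    refine ⟨hu0 x hx1, ?_⟩
    rcases hx1.eq_or_lt with h | h
    · have := hin x h
      simp only [D, h]
      nlinarith
    · have h2 := norm_pos_iff.2 (hu0 x hx1)
      have h3 : 0 < 1 - ‖x‖ ^ 2 := by nlinarith [norm_nonneg x]
      simp only [D]
      positivity
  let l : E → ℝ := fun x => (√(D x) - inner ℝ x (u x)) / ‖u x‖ ^ 2
  have hl : ContDiffOn ℝ 1 l U := by
    intro x hx
    have h2 : ‖u x‖ ^ 2 ≠ 0 := pow_ne_zero 2 (norm_ne_zero_iff.2 hx.1)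
    exact (((hD.contDiffAt.sqrt hx.2.ne').sub (contDiff_id.inner ℝ hu).contDiffAt).div
      (hu.norm_sq ℝ).contDiffAt h2).contDiffWithinAt
  refine not_exists_contDiff_retraction (r := fun x => x + l x • u x) hU hBU
    (contDiff_id.contDiffOn.add (hl.smul hu.contDiffOn)) (fun x hx => ?_) (fun x hx => ?_)
  · have hz : l x = 0 := by
      simp only [l, D, hx]
      rw [one_pow, sub_self, mul_zero, add_zero, Real.sqrt_sq (hin x hx).le, sub_self, zero_div]
    rw [hz, zero_smul, add_zero]
  · have hxU := hBU (show x ∈ Metric.closedBall 0 1 by simpa using hx)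
    have h2 : ‖u x‖ ^ 2 ≠ 0 := pow_ne_zero 2 (norm_ne_zero_iff.2 hxU.1)
    have h3 : ‖x + l x • u x‖ ^ 2 =
        ‖x‖ ^ 2 + 2 * (l x * inner ℝ x (u x)) + l x ^ 2 * ‖u x‖ ^ 2 := by
      rw [norm_add_sq_real, inner_smul_right, norm_smul, mul_pow, Real.norm_eq_abs, sq_abs]
    have h4 : l x * ‖u x‖ ^ 2 = √(D x) - inner ℝ x (u x) := div_mul_cancel₀ _ h2
    have h5 : √(D x) ^ 2 = D x := Real.sq_sqrt hxU.2.le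
    have h6 : (‖x + l x • u x‖ ^ 2 - 1) * ‖u x‖ ^ 2 = 0 := by
      have h7 : D x = inner ℝ x (u x) ^ 2 + ‖u x‖ ^ 2 * (1 - ‖x‖ ^ 2) := rfl
      have h8 : (l x * ‖u x‖ ^ 2 + inner ℝ x (u x)) ^ 2 = D x := by rw [h4, sub_add_cancel, h5]
      rw [h3]
      nlinarith
    have h9 : ‖x + l x • u x‖ ^ 2 = 1 := by
      have := (mul_eq_zero.1 h6).resolve_right h2
      linarith
    exact (pow_eq_one_iff_of_nonneg (norm_nonneg _) two_ne_zero).1 h9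

lemma exists_fixedPoint_of_continuous_of_norm_le {f : E → E} (hf : Continuous f) {r : ℝ}
    (hr : 0 < r) (hmaps : ∀ x, ‖f x‖ ≤ r) : ∃ x, f x = x := by
  -- an approximate fixed point for every `ε`, from a smooth approximation of `f`
  have happrox : ∀ ε, 0 < ε → ∃ x, ‖x‖ ≤ r + ε ∧ dist (f x) x < ε := by
    intro ε hε
    obtain ⟨g, hg, hgf, -⟩ := hf.exists_contDiff_approx 1 (ε := fun _ => ε) continuous_const
      fun _ => hε
    have hρ : 0 < r + ε := by linarith
    have hgb : ∀ x, ‖g x‖ ≤ r + ε := fun x => by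
      have h1 := hgf x
      rw [dist_eq_norm] at h1
      have h2 := norm_le_norm_add_norm_sub (f x) (g x)
      rw [norm_sub_rev] at h2
      linarith [hmaps x]
    obtain ⟨x, hx, hfx⟩ := exists_fixedPoint_of_contDiff
      (f := fun x => (r + ε)⁻¹ • g ((r + ε) • x))
      (by have := hg.comp (contDiff_id.const_smul (r + ε)); exact this.const_smul _)
      (fun x _ => by
        rw [norm_smul, Real.norm_of_nonneg (inv_nonneg.2 hρ.le), inv_mul_le_iff₀ hρ, mul_one]
        exact hgb _)
    have hgx : g ((r + ε) • x) = (r + ε) • x := by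
      conv_rhs => rw [← hfx]
      rw [smul_inv_smul₀ hρ.ne']
    refine ⟨(r + ε) • x, ?_, ?_⟩
    · rw [norm_smul, Real.norm_of_nonneg hρ.le]
      exact mul_le_of_le_one_right hρ.le hx
    · have := hgf ((r + ε) • x)
      rwa [hgx, dist_comm] at this
  obtain ⟨x, -, hx⟩ := (isCompact_closedBall (0 : E) (r + 1)).exists_isMinOn
    ⟨0, by simp; linarith⟩ (hf.dist continuous_id).continuousOn
  refine ⟨x, dist_le_zero.1 ?_⟩
  by_contra! hpos
  obtain ⟨y, hy, hyd⟩ := happrox (min 1 (dist (f x) x)) (lt_min one_pos hpos)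
  have h1 : dist (f x) x ≤ dist (f y) y :=
    hx (by simpa using hy.trans (by gcongr; exact min_le_left _ _))
  exact absurd (hyd.trans_le (min_le_right _ _)) (not_lt.2 h1)

end Brouwer

/-- **Brouwer's fixed point theorem**, for a continuous self-map with bounded range of a
finite-dimensional normed space. -/
theorem exists_fixedPoint_of_bounded_range {E : Type*} [NormedAddCommGroup E] [NormedSpace ℝ E]
    [FiniteDimensional ℝ E] {f : E → E} (hf : Continuous f)
    (hb : Bornology.IsBounded (range f)) : ∃ x, f x = x := by
  let e := toEuclidean (E := E)
  obtain ⟨r, hr⟩ := (e.lipschitz.isBounded_image hb).exists_norm_le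
  obtain ⟨x, hx⟩ := exists_fixedPoint_of_continuous_of_norm_le (f := fun x => e (f (e.symm x)))
    (by fun_prop) (r := max r 1) (by positivity)
    fun x => (hr _ ⟨_, ⟨_, rfl⟩, rfl⟩).trans (le_max_left _ _)
  exact ⟨e.symm x, by rw [← e.symm_apply_apply (f _), hx]⟩

/-! ### The planar map and its inverse branches -/

/-- A continuous bijection from a compact set onto a subset of a Hausdorff space has a continuous
inverse. -/
lemma exists_continuousOn_inverse {α β : Type*} [TopologicalSpace α] [TopologicalSpace β]
    [T2Space β] [Nonempty α] {g : α → β} {S : Set α} {T : Set β} (hS : IsCompact S)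
    (hg : ContinuousOn g S) (hb : BijOn g S T) :
    ∃ b : β → α, ContinuousOn b T ∧ (∀ q ∈ T, b q ∈ S ∧ g (b q) = q) ∧ ∀ u ∈ S, b (g u) = u := by
  have hinv := hb.invOn_invFunOn
  have hmaps : MapsTo (Function.invFunOn g S) T S := hb.surjOn.mapsTo_invFunOn
  refine ⟨Function.invFunOn g S, continuousOn_iff_isClosed.2 fun K hK => ?_,
    fun q hq => ⟨hmaps hq, hinv.2 hq⟩, fun u hu => hinv.1 hu⟩
  have hSK : IsCompact (S ∩ K) := hS.inter_right hK
  refine ⟨g '' (S ∩ K), (hSK.image_of_continuousOn (hg.mono inter_subset_left)).isClosed, ?_⟩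
  ext q
  constructor
  · rintro ⟨hqK, hqT⟩
    exact ⟨⟨_, ⟨hmaps hqT, hqK⟩, hinv.2 hqT⟩, hqT⟩
  · rintro ⟨⟨u, ⟨huS, huK⟩, rfl⟩, hqT⟩
    refine ⟨?_, hqT⟩
    rw [mem_preimage, hinv.1 huS]
    exact huK

lemma mem_square {R : ℝ} {u : ℝ × ℝ} : u ∈ square R ↔ |u.1| ≤ R ∧ |u.2| ≤ R := by
  simp only [square, mem_prod, mem_Icc, abs_le]

lemma add_mem_square {R : ℝ} {u v : ℝ × ℝ} (hu : u ∈ square R) (hv : v ∈ square R) :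
    u + v ∈ square (2 * R) := by
  rw [mem_square] at *
  exact ⟨(abs_add_le _ _).trans (by linarith), (abs_add_le _ _).trans (by linarith)⟩

lemma isCompact_square (R : ℝ) : IsCompact (square R) := isCompact_Icc.prod isCompact_Icc

/-- In rotated coordinates the coupled Hénon map is `(u, v) ↦ (planarMap u - v, u)`, where `u`
stands for `(X, Y)` and `v` for `(Z, W)`. -/
def planarMap (A₀ A₁ c : ℝ) (u : ℝ × ℝ) : ℝ × ℝ :=
  (A₀ - u.1 ^ 2 - u.2 ^ 2, A₁ + 2 * (c - u.1) * u.2)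

lemma continuous_planarMap (A₀ A₁ c : ℝ) : Continuous (planarMap A₀ A₁ c) := by
  unfold planarMap; fun_prop

/-- The closed half plane `X ≥ 0` (for `true`) or `X ≤ 0` (for `false`). -/
def halfPlane : Bool → Set (ℝ × ℝ)
  | true => {u | 0 ≤ u.1}
  | false => {u | u.1 ≤ 0}

lemma isClosed_halfPlane (i : Bool) : IsClosed (halfPlane i) := by
  cases i
  · exact isClosed_le continuous_fst continuous_const
  · exact isClosed_le continuous_const continuous_fst

lemma exists_mem_halfPlane (u : ℝ × ℝ) : u ∈ halfPlane false ∨ u ∈ halfPlane true :=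
  le_total u.1 0

/-- The parameter conditions under which the coupled Hénon map has a binary horseshoe on the box of
half-width `R`: on the horseshoe `|Y| ≤ W`, and `W ^ 2 + 2 * R < A₀` keeps `X` away from `0`. -/
structure HorseshoeParams (A₀ A₁ c R W : ℝ) : Prop where
  pos : 0 < R
  eq : A₀ = R ^ 2 - 2 * R
  lt : R < c
  nonneg : 0 ≤ W
  bound : 2 * R + |A₁| ≤ 2 * (c - R) * W
  le : W ≤ R
  gap : W ^ 2 + 2 * R < A₀

namespace HorseshoeParams

variable {A₀ A₁ c R W : ℝ} (h : HorseshoeParams A₀ A₁ c R W)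
include h

lemma abs_snd_le {u : ℝ × ℝ} (hu : u ∈ square R)
    (hG : planarMap A₀ A₁ c u ∈ square (2 * R)) : |u.2| ≤ W := by
  rw [mem_square] at hu hG
  have h1 : 2 * (c - u.1) * |u.2| ≤ 2 * R + |A₁| := by
    have hc : 0 < 2 * (c - u.1) := by linarith [h.lt, (abs_le.1 hu.1).2]
    rw [← abs_of_pos hc, ← abs_mul]
    have h2 := abs_sub (A₁ + 2 * (c - u.1) * u.2) A₁
    rw [add_sub_cancel_left] at h2
    exact h2.trans (add_le_add_left hG.2 _)
  have h3 := h.bound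
  have h4 := h.lt
  have h5 : 2 * (c - R) * |u.2| ≤ 2 * (c - u.1) * |u.2| := by
    gcongr
    exact (abs_le.1 hu.1).2
  exact le_of_mul_le_mul_left (by linarith) (by linarith : 0 < 2 * (c - R))

lemma sq_fst_ge {u : ℝ × ℝ} (hu : u ∈ square R)
    (hG : planarMap A₀ A₁ c u ∈ square (2 * R)) : A₀ - W ^ 2 - 2 * R ≤ u.1 ^ 2 := by
  have h1 : u.2 ^ 2 ≤ W ^ 2 := sq_le_sq' (by linarith [(abs_le.1 (h.abs_snd_le hu hG)).1])
    (abs_le.1 (h.abs_snd_le hu hG)).2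
  have h2 : A₀ - u.1 ^ 2 - u.2 ^ 2 ≤ 2 * R := (abs_le.1 (mem_square.1 hG).1).2
  linarith

lemma fst_ne_zero {u : ℝ × ℝ} (hu : u ∈ square R)
    (hG : planarMap A₀ A₁ c u ∈ square (2 * R)) : u.1 ≠ 0 := by
  intro h0
  have := h.sq_fst_ge hu hG
  rw [h0] at this
  linarith [h.gap]

/-- Along a level curve of the second component of the planar map, the first component is strictly
monotone on each of the two halves of the square, as far as it takes values in `[-2R, 2R]`: for
`X ≥ 0` this is clear, and for `X ≤ 0` it comes from convexity. -/
lemma fst_le_of_planarMap_eq {i : Bool} {u v : ℝ × ℝ} (hv : v ∈ square R)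
    (hui : u ∈ halfPlane i) (hvi : v ∈ halfPlane i)
    (hG : planarMap A₀ A₁ c u ∈ square (2 * R)) (huv : planarMap A₀ A₁ c u = planarMap A₀ A₁ c v) :
    v.1 ≤ u.1 := by
  by_contra! hlt
  have hGv := huv ▸ hG
  obtain ⟨hv1, hv2⟩ := mem_square.1 hv
  obtain ⟨e1, e2⟩ := Prod.ext_iff.1 huv
  simp only [planarMap] at e1 e2
  have hc := h.lt
  have hR := h.pos
  have e3 : (c - u.1) * u.2 = (c - v.1) * v.2 := by linarith
  have hcv : 0 < c - v.1 := by linarith [(abs_le.1 hv1).2]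
  have e4 : (c - u.1) ^ 2 * u.2 ^ 2 = (c - v.1) ^ 2 * v.2 ^ 2 := by
    rw [← mul_pow, e3, mul_pow]
  have e5 : u.2 ^ 2 ≤ v.2 ^ 2 := by
    have : (c - v.1) ^ 2 ≤ (c - u.1) ^ 2 := by gcongr
    by_contra! hcon
    nlinarith [mul_pos hcv hcv]
  cases i with
  | true =>
    have h1 : 0 ≤ u.1 := hui
    nlinarith
  | false =>
    have h1 : v.1 ≤ 0 := hvi
    obtain ⟨a, ha⟩ : ∃ a, u.1 = -a := ⟨-u.1, by ring⟩
    obtain ⟨b, hb⟩ : ∃ b, v.1 = -b := ⟨-v.1, by ring⟩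
    rw [ha, hb] at e1 e3 e4
    have hb0 : 0 < b := lt_of_le_of_ne (by linarith) fun h0 =>
      h.fst_ne_zero hv hGv (by rw [hb, ← h0, neg_zero])
    have hab : b < a := by linarith
    simp only [sub_neg_eq_add] at e3 e4
    -- the value at `X = 0` lies strictly below the prescribed one
    have hq : ((c + b) * v.2) ^ 2 ≤ (c * W) ^ 2 := by
      apply sq_le_sq.2
      have hGv2 := (mem_square.1 hGv).2
      simp only [planarMap] at hGv2
      rw [hb, sub_neg_eq_add] at hGv2
      have h2 := abs_sub (A₁ + 2 * (c + b) * v.2) A₁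
      rw [add_sub_cancel_left, mul_assoc, abs_mul, abs_two] at h2
      rw [abs_of_nonneg (mul_nonneg (hR.trans hc).le h.nonneg)]
      rw [mul_assoc] at hGv2
      nlinarith [h.bound, mul_nonneg hR.le h.nonneg]
    have hP : W ^ 2 < b ^ 2 + v.2 ^ 2 := by
      have h2 := h.sq_fst_ge hv hGv
      have h3 : A₀ - v.1 ^ 2 - v.2 ^ 2 ≤ 2 * R := (abs_le.1 (mem_square.1 hGv).1).2
      rw [hb, neg_sq] at h3
      linarith [h.gap]
    have hc0 : 0 < c := hR.trans hc
    have h4 : v.2 ^ 2 * (2 * c + b) < b * c ^ 2 := by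
      have h5 : c ^ 2 * W ^ 2 < c ^ 2 * (b ^ 2 + v.2 ^ 2) := by gcongr
      have h6 : b * (v.2 ^ 2 * (2 * c + b)) < b * (b * c ^ 2) := by nlinarith
      exact lt_of_mul_lt_mul_left h6 hb0.le
    have h7 : (a + b) * (c + b) ^ 2 = u.2 ^ 2 * (2 * c + a + b) := by
      have h8 : (a - b) * ((a + b) * (c + b) ^ 2) = (a - b) * (u.2 ^ 2 * (2 * c + a + b)) := by
        have h9 : a ^ 2 - b ^ 2 = v.2 ^ 2 - u.2 ^ 2 := by linarith
        calc (a - b) * ((a + b) * (c + b) ^ 2) = (a ^ 2 - b ^ 2) * (c + b) ^ 2 := by ring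
          _ = (c + b) ^ 2 * v.2 ^ 2 - u.2 ^ 2 * (c + b) ^ 2 := by rw [h9]; ring
          _ = _ := by rw [← e4]; ring
      exact mul_left_cancel₀ (by linarith : a - b ≠ 0) h8
    have h10 : (a + b) * (c + b) ^ 2 ≤ v.2 ^ 2 * (2 * c + a + b) := by
      rw [h7]
      exact mul_le_mul_of_nonneg_right e5 (by linarith)
    have h11 : (a + b) * c ^ 2 ≤ (a + b) * (c + b) ^ 2 := by
      have h13 : c ≤ c + b := by linarith
      have h14 : 0 ≤ a + b := by linarith
      gcongr
    have hcab : 0 < 2 * c + a + b := by linarith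
    have hcb : 0 < 2 * c + b := by linarith
    have h12 : (a + b) * c ^ 2 * (2 * c + b) < b * c ^ 2 * (2 * c + a + b) := by
      calc (a + b) * c ^ 2 * (2 * c + b) ≤ v.2 ^ 2 * (2 * c + a + b) * (2 * c + b) :=
            mul_le_mul_of_nonneg_right (h11.trans h10) hcb.le
        _ = v.2 ^ 2 * (2 * c + b) * (2 * c + a + b) := by ring
        _ < _ := by gcongr
    nlinarith [pow_pos hc0 3, mul_pos (pow_pos hc0 3) (by linarith : 0 < a)]

lemma eq_of_planarMap_eq {i : Bool} {u v : ℝ × ℝ} (hu : u ∈ square R) (hv : v ∈ square R)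
    (hui : u ∈ halfPlane i) (hvi : v ∈ halfPlane i)
    (hG : planarMap A₀ A₁ c u ∈ square (2 * R))
    (huv : planarMap A₀ A₁ c u = planarMap A₀ A₁ c v) : u = v := by
  have h1 : u.1 = v.1 := le_antisymm
    (h.fst_le_of_planarMap_eq hu hvi hui (huv ▸ hG) huv.symm)
    (h.fst_le_of_planarMap_eq hv hui hvi hG huv)
  refine Prod.ext h1 ?_
  have h2 := (Prod.ext_iff.1 huv).2
  simp only [planarMap, h1] at h2
  have hc : c - v.1 ≠ 0 := by
    have := (abs_le.1 (mem_square.1 hv).1).2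
    have := h.lt
    linarith
  have h3 : (c - v.1) * (u.2 - v.2) = 0 := by linarith
  exact sub_eq_zero.1 ((mul_eq_zero.1 h3).resolve_left hc)

lemma exists_planarMap_eq (i : Bool) {q : ℝ × ℝ} (hq : q ∈ square (2 * R)) :
    ∃ u ∈ square R, u ∈ halfPlane i ∧ planarMap A₀ A₁ c u = q := by
  obtain ⟨hq1, hq2⟩ := mem_square.1 hq
  have hR := h.pos
  have hc := h.lt
  let k := (q.2 - A₁) / 2
  have hk : |k| ≤ (c - R) * W := by
    have h1 := abs_sub q.2 A₁
    simp only [k]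
    rw [abs_div, abs_two]
    linarith [h.bound]
  -- along the curve `(c - X) * Y = k` the first component is governed by `g`
  let g : ℝ → ℝ := fun X => X ^ 2 + (k / (c - X)) ^ 2
  have hne : ∀ X ∈ Icc (-R) R, c - X ≠ 0 := fun X hX => by linarith [hX.2]
  have hg : ContinuousOn g (Icc (-R) R) :=
    (continuousOn_id.pow 2).add
      ((continuousOn_const.div (continuousOn_const.sub continuousOn_id) hne).pow 2)
  have hY : ∀ X ∈ Icc (-R) R, |k / (c - X)| ≤ W := by
    intro X hX
    have hcX : 0 < c - X := by linarith [hX.2]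
    rw [abs_div, abs_of_pos hcX, div_le_iff₀ hcX]
    nlinarith [hX.2, h.nonneg]
  have hg0 : g 0 ≤ A₀ - q.1 := by
    have h1 := sq_le_sq' (abs_le.1 (hY 0 ⟨by linarith, hR.le⟩)).1
      (abs_le.1 (hY 0 ⟨by linarith, hR.le⟩)).2
    have h2 : g 0 = (k / (c - 0)) ^ 2 := by simp [g]
    rw [h2]
    linarith [h.gap, (abs_le.1 hq1).2]
  have hg1 : ∀ X, X ^ 2 = R ^ 2 → A₀ - q.1 ≤ g X := by
    intro X hX
    have h1 : R ^ 2 ≤ g X := by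
      simp only [g, hX]
      linarith [sq_nonneg (k / (c - X))]
    linarith [h.eq, (abs_le.1 hq1).1]
  have hsol : ∃ X ∈ Icc (-R) R, (X, k / (c - X)) ∈ halfPlane i ∧ g X = A₀ - q.1 := by
    cases i with
    | true =>
      obtain ⟨X, hX, hgX⟩ := intermediate_value_Icc hR.le
        (hg.mono (Icc_subset_Icc_left (by linarith))) ⟨hg0, hg1 R rfl⟩
      exact ⟨X, ⟨by linarith [hX.1], hX.2⟩, hX.1, hgX⟩
    | false =>
      obtain ⟨X, hX, hgX⟩ := intermediate_value_Icc' (by linarith : -R ≤ 0)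
        (hg.mono (Icc_subset_Icc_right hR.le)) ⟨hg0, hg1 (-R) (neg_sq R)⟩
      exact ⟨X, ⟨hX.1, by linarith [hX.2]⟩, hX.2, hgX⟩
  obtain ⟨X, hX, hXi, hgX⟩ := hsol
  refine ⟨(X, k / (c - X)), mem_square.2 ⟨abs_le.2 hX, (hY X hX).trans h.le⟩, hXi, ?_⟩
  refine Prod.ext ?_ ?_
  · simp only [g] at hgX
    simp only [planarMap]
    linarith
  · simp only [planarMap, k]
    field_simp [hne X hX]
    ring

/-- The continuous inverse branch of the planar map over the square of half-width `2R`, extended to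
the whole plane by precomposition with the coordinatewise projection onto that square. -/
lemma exists_inverseBranch (i : Bool) :
    ∃ B : ℝ × ℝ → ℝ × ℝ, Continuous B ∧ (∀ q, B q ∈ square R ∧ B q ∈ halfPlane i) ∧
      (∀ q ∈ square (2 * R), planarMap A₀ A₁ c (B q) = q) ∧
      ∀ u ∈ square R, u ∈ halfPlane i → planarMap A₀ A₁ c u ∈ square (2 * R) →
        B (planarMap A₀ A₁ c u) = u := by
  have hcont := continuous_planarMap A₀ A₁ c
  let S : Set (ℝ × ℝ) :=
    square R ∩ (halfPlane i ∩ planarMap A₀ A₁ c ⁻¹' square (2 * R))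
  have hS : IsCompact S := (isCompact_square R).inter_right
    ((isClosed_halfPlane i).inter ((isCompact_square _).isClosed.preimage hcont))
  have hb : BijOn (planarMap A₀ A₁ c) S (square (2 * R)) := by
    refine ⟨fun u hu => hu.2.2, fun u hu v hv huv => ?_, fun q hq => ?_⟩
    · exact h.eq_of_planarMap_eq hu.1 hv.1 hu.2.1 hv.2.1 hu.2.2 huv
    · obtain ⟨u, hu, hui, huq⟩ := h.exists_planarMap_eq i hq
      exact ⟨u, ⟨hu, hui, by rw [mem_preimage, huq]; exact hq⟩, huq⟩
  obtain ⟨b, hbc, hbT, hbS⟩ := exists_continuousOn_inverse hS hcont.continuousOn hb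
  have hR2 : -(2 * R) ≤ 2 * R := by linarith [h.pos]
  let P : ℝ × ℝ → ℝ × ℝ := fun q =>
    (max (-(2 * R)) (min (2 * R) q.1), max (-(2 * R)) (min (2 * R) q.2))
  have hP : ∀ q, P q ∈ square (2 * R) := fun q =>
    ⟨⟨le_max_left _ _, max_le hR2 (min_le_left _ _)⟩,
      ⟨le_max_left _ _, max_le hR2 (min_le_left _ _)⟩⟩
  have hPid : ∀ q ∈ square (2 * R), P q = q := by
    rintro q ⟨h1, h2⟩
    simp only [P, min_eq_right h1.2, min_eq_right h2.2, max_eq_right h1.1, max_eq_right h2.1]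
  refine ⟨b ∘ P, hbc.comp_continuous (by fun_prop) hP,
    fun q => ⟨(hbT _ (hP q)).1.1, (hbT _ (hP q)).1.2.1⟩, fun q hq => ?_, fun u hu hui hG => ?_⟩
  · rw [Function.comp_apply, hPid q hq]
    exact (hbT q hq).2
  · rw [Function.comp_apply, hPid _ hG]
    exact hbS u ⟨hu, hui, hG⟩

/-- Every finite cyclic word of symbols is the itinerary of a periodic sequence, by Brouwer's
theorem applied to the inverse branches. -/
lemma exists_periodic_sequence {N : ℕ} [NeZero N] (s : ZMod N → Bool) :
    ∃ v : ZMod N → ℝ × ℝ, ∀ n, v n ∈ square R ∧ v n ∈ halfPlane (s n) ∧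
      planarMap A₀ A₁ c (v n) = v (n + 1) + v (n - 1) := by
  choose B hBc hBm hBr _ using h.exists_inverseBranch
  obtain ⟨v, hv⟩ := exists_fixedPoint_of_bounded_range
    (f := fun (v : ZMod N → ℝ × ℝ) n => B (s n) (v (n + 1) + v (n - 1)))
    (continuous_pi fun n => (hBc _).comp (by fun_prop))
    ((Bornology.IsBounded.pi (fun _ => (isCompact_square R).isBounded)).subset
      (by rintro _ ⟨v, rfl⟩ n -; exact (hBm _ _).1))
  have hv' : ∀ n, B (s n) (v (n + 1) + v (n - 1)) = v n := fun n => congrFun hv n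
  have hmem : ∀ n, v n ∈ square R := fun n => hv' n ▸ (hBm _ _).1
  refine ⟨v, fun n => ⟨hmem n, hv' n ▸ (hBm _ _).2, ?_⟩⟩
  rw [← hv' n]
  exact hBr _ _ (add_mem_square (hmem _) (hmem _))

end HorseshoeParams

/-! ### Non-wandering points -/

section Nonwandering

variable {M M' : Type*} [TopologicalSpace M] [TopologicalSpace M']

lemma Homeomorph.mem_nonwanderingSet_iff_of_semiconj (h : M ≃ₜ M') {f : M → M} {g : M' → M'}
    (hfg : Function.Semiconj h f g) {p : M} :
    h p ∈ nonwanderingSet g ↔ p ∈ nonwanderingSet f := by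
  constructor
  · intro hp U hU hpU
    obtain ⟨n, hn, -, ⟨_, ⟨q, hq, rfl⟩, rfl⟩, q', hq', hqq'⟩ :=
      hp (h '' U) (h.isOpenMap U hU) (mem_image_of_mem h hpU)
    refine ⟨n, hn, _, ⟨q, hq, rfl⟩, ?_⟩
    rw [← (hfg.iterate_right n).eq] at hqq'
    rwa [← h.injective hqq']
  · intro hp U hU hpU
    obtain ⟨n, hn, -, ⟨q, hq, rfl⟩, hq'⟩ := hp (h ⁻¹' U) (hU.preimage h.continuous) hpU
    refine ⟨n, hn, _, ⟨h q, hq, rfl⟩, ?_⟩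
    rw [← (hfg.iterate_right n).eq]
    exact hq'

lemma nonwanderingSet_symm (f : M ≃ₜ M) : nonwanderingSet f.symm = nonwanderingSet f := by
  have key : ∀ g : M ≃ₜ M, nonwanderingSet g ⊆ nonwanderingSet g.symm := by
    intro g p hp U hU hpU
    obtain ⟨n, hn, -, ⟨q, hq, rfl⟩, hq'⟩ := hp U hU hpU
    exact ⟨n, hn, q, ⟨_, hq', g.toEquiv.left_inv.iterate n q⟩, hq⟩
  exact Subset.antisymm (key f.symm) (key f)

lemma Homeomorph.image_nonwanderingSet (f : M ≃ₜ M) :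
    f '' nonwanderingSet f = nonwanderingSet f := by
  have hf : ∀ p, f p ∈ nonwanderingSet f ↔ p ∈ nonwanderingSet f := fun p =>
    f.mem_nonwanderingSet_iff_of_semiconj fun _ => rfl
  ext p
  constructor
  · rintro ⟨q, hq, rfl⟩
    exact (hf q).2 hq
  · intro hp
    exact ⟨f.symm p, (hf _).1 (by rwa [f.apply_symm_apply]), f.apply_symm_apply p⟩

lemma Homeomorph.zpow_mem_nonwanderingSet (f : M ≃ₜ M) {p : M} (hp : p ∈ nonwanderingSet f)
    (n : ℤ) : (f ^ n) p ∈ nonwanderingSet f := by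
  refine ((f ^ n).mem_nonwanderingSet_iff_of_semiconj fun q => ?_).2 hp
  exact DFunLike.congr_fun (Commute.self_zpow f n).eq.symm q

lemma isClosed_nonwanderingSet (f : M → M) : IsClosed (nonwanderingSet f) := by
  rw [← isOpen_compl_iff, isOpen_iff_forall_mem_open]
  intro p hp
  simp only [mem_compl_iff, nonwanderingSet, mem_ofPred_eq, not_forall] at hp
  obtain ⟨U, hU, hpU, hn⟩ := hp
  exact ⟨U, fun q hq hq' => hn (hq' U hU hq), hU, hpU⟩

/-- An open forward invariant set with a strict Lyapunov function is wandering. -/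
lemma notMem_nonwanderingSet_of_lyapunov {f : M → M} (hf : Continuous f) {N : Set M}
    (hN : IsOpen N) (hfN : MapsTo f N N) {L : M → ℝ} (hL : Continuous L)
    (hdec : ∀ x ∈ N, L (f x) < L x) {p : M} (hp : p ∈ N) : p ∉ nonwanderingSet f := by
  intro hnw
  obtain ⟨m, hm, hm'⟩ := exists_between (hdec p hp)
  obtain ⟨n, hn, -, ⟨q, ⟨⟨hqN, hq1⟩, hq2⟩, rfl⟩, ⟨-, hq'⟩, -⟩ :=
    hnw ((N ∩ {x | m < L x}) ∩ {x | L (f x) < m})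
      ((hN.inter (isOpen_lt continuous_const hL)).inter
        (isOpen_lt (hL.comp hf) continuous_const)) ⟨⟨hp, hm'⟩, hm⟩
  have key : ∀ k : ℕ, f^[k + 1] q ∈ N ∧ L (f^[k + 1] q) < m := by
    intro k
    induction k with
    | zero => exact ⟨hfN hqN, hq2⟩
    | succ k ih =>
      rw [Function.iterate_succ_apply']
      exact ⟨hfN ih.1, (hdec _ ih.1).trans ih.2⟩
  obtain ⟨k, rfl⟩ := Nat.exists_eq_succ_of_ne_zero hn.ne'
  exact lt_asymm hq' (key k).2

lemma mem_nonwanderingSet_of_periodic {f : M → M} {p : M} {n : ℕ} (hn : 0 < n)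
    (hp : f^[n] p = p) : p ∈ nonwanderingSet f :=
  fun _ _ hpU => ⟨n, hn, p, ⟨p, hpU, hp⟩, hpU⟩

end Nonwandering

/-! ### Full components and itineraries -/

section Horseshoe

variable {M E₁ E₂ : Type*} [TopologicalSpace M] [TopologicalSpace E₁] [TopologicalSpace E₂]

/-- A criterion for full components: one of two disjoint closed connected pieces `C`, `C'` of
`Δ ∩ f Δ` is a full component as soon as prescribing the second coordinate of a point in `f⁻¹ C`
and the first coordinate of its image determines the point. The last condition is symmetric under
passing to the inverse and exchanging the coordinates. -/
lemma isFullComponent_of_existsUnique {f : M ≃ₜ M} {φ : M ≃ₜ E₁ × E₂} {D₁ : Set E₁} {D₂ : Set E₂}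
    {C C' : Set M} (hD₁ : D₁.Nonempty) (hC : IsClosed C) (hC' : IsClosed C') (hCC' : Disjoint C C')
    (hunion : φ ⁻¹' (D₁ ×ˢ D₂) ∩ f '' (φ ⁻¹' (D₁ ×ˢ D₂)) = C ∪ C')
    (hconn : IsConnected C)
    (hex : ∀ t ∈ D₁, ∀ z ∈ D₂, ∃! q, f q ∈ C ∧ (φ (f q)).1 = t ∧ (φ q).2 = z) :
    IsFullComponent f φ D₁ D₂ C := by
  obtain ⟨p, hp⟩ := hconn.nonempty
  have hsub : C ⊆ φ ⁻¹' (D₁ ×ˢ D₂) ∩ f '' (φ ⁻¹' (D₁ ×ˢ D₂)) := hunion ▸ subset_union_left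
  have hpre : ∀ q, f q ∈ C → (φ q).1 ∈ D₁ ∧ (φ q).2 ∈ D₂ := by
    intro q hq
    obtain ⟨q', hq', hqq'⟩ := (hsub hq).2
    rw [← f.injective hqq']
    exact hq'
  refine ⟨⟨p, hsub hp, Subset.antisymm ?_ ?_⟩, ?_, fun z hz => ⟨?_, ?_, ?_⟩⟩
  · exact hconn.isPreconnected.subset_connectedComponentIn hp hsub
  · have hpc : p ∈ connectedComponentIn (φ ⁻¹' (D₁ ×ˢ D₂) ∩ f '' (φ ⁻¹' (D₁ ×ˢ D₂))) p :=
      mem_connectedComponentIn (hsub hp)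
    refine ((isPreconnected_iff_subset_of_disjoint_closed.1 isPreconnected_connectedComponentIn)
      C C' hC hC' ?_ ?_).resolve_right fun h => disjoint_left.1 hCC' hp (h hpc)
    · rw [← hunion]
      exact connectedComponentIn_subset _ _
    · rw [hCC'.inter_eq, inter_empty]
  · refine Subset.antisymm ?_ fun z hz => ?_
    · rintro _ ⟨q, hq, rfl⟩
      exact (hpre q hq).2
    · obtain ⟨t, ht⟩ := hD₁
      obtain ⟨q, ⟨hq, -, hqz⟩, -⟩ := hex t ht z hz
      exact ⟨q, hq, hqz⟩
  · rintro _ ⟨q, ⟨hq, -⟩, rfl⟩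
    exact (hsub hq).1.1
  · rintro _ ⟨q, ⟨hq, hqz⟩, rfl⟩ _ ⟨q', ⟨hq', hqz'⟩, rfl⟩ hqq'
    have h1 : (φ q).2 = (φ z).2 := hqz.2
    have h2 : (φ q').2 = (φ z).2 := hqz'.2
    rw [(hex _ (hsub hq').1.1 _ (hpre z hz).2).unique ⟨hq, hqq', h1⟩ ⟨hq', rfl, h2⟩]
  · intro t ht
    obtain ⟨q, ⟨hq, hqt, hqz⟩, -⟩ := hex t ht _ (hpre z hz).2
    exact ⟨f q, ⟨q, ⟨hq, (hpre q hq).1, hqz⟩, rfl⟩, hqt⟩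

/-- If every point of the non-wandering set lies in one of two disjoint closed pieces, and every
periodic itinerary is realized by a periodic point, then the itinerary map is a semi-conjugacy onto
the full shift. -/
lemma exists_itinerary_semiconj (f : M ≃ₜ M) {C : Bool → Set M} (hC : ∀ i, IsClosed (C i))
    (hdisj : Disjoint (C false) (C true)) (hcomp : IsCompact (nonwanderingSet f))
    (hsub : nonwanderingSet f ⊆ C false ∪ C true)
    (hper : ∀ (N : ℕ) [NeZero N] (s : ZMod N → Bool),
      ∃ p, f^[N] p = p ∧ ∀ n : ℤ, (f ^ n) p ∈ C (s n)) :
    ∃ π : M → ℤ → Bool, ContinuousOn π (nonwanderingSet f) ∧ π '' nonwanderingSet f = univ ∧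
      (∀ p ∈ nonwanderingSet f, π (f p) = fullShift (π p)) ∧
      ∀ p ∈ nonwanderingSet f, ∀ n : ℤ, (f ^ n) p ∈ C (π p n) := by
  classical
  let π : M → ℤ → Bool := fun p n => decide ((f ^ n) p ∈ C true)
  have hπ : ∀ p ∈ nonwanderingSet f, ∀ n : ℤ, (f ^ n) p ∈ C (π p n) := by
    intro p hp n
    by_cases h : (f ^ n) p ∈ C true
    · simp [π, h]
    · simpa [π, h] using (hsub (f.zpow_mem_nonwanderingSet hp n)).resolve_right h
  have hne : ∀ {x : M} {i j : Bool}, x ∈ C i → x ∈ C j → i = j := by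
    intro x i j hi hj
    cases i <;> cases j <;> first | rfl | skip
    · exact (disjoint_left.1 hdisj hi hj).elim
    · exact (disjoint_left.1 hdisj hj hi).elim
  refine ⟨π, continuousOn_pi.2 fun n p hp => ?_, ?_, fun p _ => ?_, hπ⟩
  · have h1 : (f ^ n) p ∉ C (!π p n) := fun h => by simpa using hne (hπ p hp n) h
    have h2 : ∀ᶠ q in nhdsWithin p (nonwanderingSet f), (f ^ n) q ∉ C (!π p n) :=
      nhdsWithin_le_nhds (((hC _).isOpen_compl.preimage (f ^ n).continuous).mem_nhds h1)
    refine ContinuousWithinAt.congr_of_eventuallyEq (f := fun _ => π p n)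
      continuousWithinAt_const ?_ rfl
    filter_upwards [h2, self_mem_nhdsWithin] with q hq hqΩ
    by_contra hcon
    have h3 := hπ q hqΩ n
    rw [Bool.eq_not_of_ne hcon] at h3
    exact hq h3
  · refine eq_univ_of_forall fun s => ?_
    -- the points of `Ω` whose itinerary agrees with `s` on `[-k, k]`
    let K : ℕ → Set M := fun k =>
      nonwanderingSet f ∩ ⋂ n ∈ Icc (-(k : ℤ)) k, (f ^ n) ⁻¹' C (s n)
    have hKc : ∀ k, IsClosed (K k) := fun k => (isClosed_nonwanderingSet f).inter
      (isClosed_biInter fun n _ => (hC _).preimage (f ^ n).continuous)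
    have hKn : ∀ k, (K k).Nonempty := by
      intro k
      obtain ⟨p, hp, hps⟩ := hper (2 * k + 1) fun r => s r.valMinAbs
      refine ⟨p, mem_nonwanderingSet_of_periodic (Nat.succ_pos _) hp, mem_iInter₂.2 fun n hn => ?_⟩
      have h1 : ((n : ℤ) : ZMod (2 * k + 1)).valMinAbs = n := by
        rw [ZMod.valMinAbs_spec]
        refine ⟨rfl, ?_, ?_⟩ <;> push_cast <;> linarith [hn.1, hn.2]
      have h2 := hps n
      rwa [h1] at h2
    obtain ⟨p, hp⟩ := IsCompact.nonempty_iInter_of_sequence_nonempty_isCompact_isClosed K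
      (fun k x hx => ⟨hx.1, mem_iInter₂.2 fun n hn => mem_iInter₂.1 hx.2 n
        ⟨by push_cast; linarith [hn.1], by push_cast; linarith [hn.2]⟩⟩)
      hKn (hcomp.of_isClosed_subset (hKc 0) inter_subset_left) hKc
    have hpk := mem_iInter.1 hp
    refine ⟨p, (hpk 0).1, funext fun n => ?_⟩
    have h1 : (f ^ n) p ∈ C (s n) := mem_iInter₂.1 (hpk n.natAbs).2 n
      ⟨by rw [Int.natCast_natAbs]; exact neg_abs_le n,
        by rw [Int.natCast_natAbs]; exact le_abs_self n⟩
    exact hne (hπ p (hpk 0).1 n) h1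
  · funext n
    have h1 : (f ^ n) (f p) = (f ^ (n + 1)) p := by
      rw [zpow_add_one]; rfl
    simp only [π, fullShift, h1]

lemma hasBinaryHorseshoe_of_existsUnique {f : M ≃ₜ M} {φ : M ≃ₜ E₁ × E₂} {D₁ : Set E₁}
    {D₂ : Set E₂} {C : Bool → Set M} (hD₁ : D₁.Nonempty) (hD₂ : D₂.Nonempty)
    (hC : ∀ i, IsClosed (C i)) (hdisj : Disjoint (C false) (C true))
    (hunion : φ ⁻¹' (D₁ ×ˢ D₂) ∩ f '' (φ ⁻¹' (D₁ ×ˢ D₂)) = C false ∪ C true)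
    (hconn : ∀ i, IsConnected (C i))
    (hex : ∀ i, ∀ t ∈ D₁, ∀ z ∈ D₂, ∃! q, f q ∈ C i ∧ (φ (f q)).1 = t ∧ (φ q).2 = z)
    (hcomp : IsCompact (nonwanderingSet f)) (hΩ : nonwanderingSet f ⊆ φ ⁻¹' (D₁ ×ˢ D₂))
    (hper : ∀ (N : ℕ) [NeZero N] (s : ZMod N → Bool),
      ∃ p, f^[N] p = p ∧ ∀ n : ℤ, (f ^ n) p ∈ C (s n)) :
    HasBinaryHorseshoe f φ D₁ D₂ := by
  have hdisj' : ∀ i, Disjoint (C i) (C !i) := by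
    rintro (_ | _)
    exacts [hdisj, hdisj.symm]
  have hunion' : ∀ i, φ ⁻¹' (D₁ ×ˢ D₂) ∩ f '' (φ ⁻¹' (D₁ ×ˢ D₂)) = C i ∪ C !i := by
    rintro (_ | _)
    exacts [hunion, hunion.trans (union_comm _ _)]
  have hsub : nonwanderingSet f ⊆ C false ∪ C true := by
    rw [← hunion]
    refine subset_inter hΩ ?_
    conv_lhs => rw [← f.image_nonwanderingSet]
    exact image_mono hΩ
  refine ⟨C, hdisj, hunion, fun i => ?_, fun i => ?_, f.image_nonwanderingSet,
    exists_itinerary_semiconj f hC hdisj hcomp hsub hper⟩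
  · exact isFullComponent_of_existsUnique hD₁ (hC i) (hC _) (hdisj' i) (hunion' i) (hconn i) (hex i)
  · refine isFullComponent_of_existsUnique (C' := f ⁻¹' C !i) hD₂ ((hC i).preimage f.continuous)
      ((hC _).preimage f.continuous) ((hdisj' i).preimage f) ?_ ?_ ?_
    · have h1 : (φ.trans (Homeomorph.prodComm E₁ E₂)) ⁻¹' (D₂ ×ˢ D₁) = φ ⁻¹' (D₁ ×ˢ D₂) := by
        ext p
        exact and_comm
      rw [h1, ← preimage_union, ← hunion' i, preimage_inter, preimage_image_eq _ f.injective,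
        f.image_symm, inter_comm]
    · rw [← f.image_symm]
      exact (hconn i).image _ f.symm.continuous.continuousOn
    · intro t ht z hz
      obtain ⟨q, ⟨h1, h2, h3⟩, hq⟩ := hex i z hz t ht
      refine ⟨f q, ⟨?_, ?_, h2⟩, ?_⟩
      · simpa using h1
      · simpa using h3
      · rintro q' ⟨h1', h2', h3'⟩
        rw [← hq (f.symm q') ⟨h1', by simpa using h3', h2'⟩, f.apply_symm_apply]

end Horseshoe

/-! ### The coupled Hénon map in rotated coordinates -/

section CoupledHenon

variable {a₀ a₁ c A₀ A₁ R : ℝ}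

lemma rotatedCoords_coupledHenon (hA₀ : A₀ = (a₀ + a₁) / 2) (hA₁ : A₁ = (a₀ - a₁) / 2)
    (p : PhaseSpace) : rotatedCoords (coupledHenon a₀ a₁ c p)
      = (planarMap A₀ A₁ c (rotatedCoords p).1 - (rotatedCoords p).2, (rotatedCoords p).1) := by
  obtain ⟨⟨x, y⟩, ⟨z, w⟩⟩ := p
  simp only [rotatedCoords, coupledHenon, planarMap, Homeomorph.homeomorph_mk_coe, Equiv.coe_fn_mk,
    Prod.mk.injEq, hA₀, hA₁, Prod.mk_sub_mk, and_true]
  constructor <;> ring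

lemma boxVF_eq_preimage (R : ℝ) : boxVF R = rotatedCoords ⁻¹' (square R ×ˢ square R) := by
  ext p
  simp only [mem_preimage, mem_prod, mem_square, and_assoc]
  rfl

lemma isCompact_boxVF (R : ℝ) : IsCompact (boxVF R) := by
  rw [boxVF_eq_preimage]
  exact rotatedCoords.isCompact_preimage.2 ((isCompact_square R).prod (isCompact_square R))

/-- Time reversal: exchanging `(x, y)` and `(z, w)` conjugates the coupled Hénon map to its
inverse. -/
lemma semiconj_prodComm_coupledHenon (a₀ a₁ c : ℝ) :
    Function.Semiconj (Homeomorph.prodComm (ℝ × ℝ) (ℝ × ℝ)) (coupledHenon a₀ a₁ c)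
      (coupledHenon a₀ a₁ c).symm :=
  fun _ => rfl

lemma swap_mem_nonwanderingSet {p : PhaseSpace}
    (hp : p ∈ nonwanderingSet (coupledHenon a₀ a₁ c)) :
    p.swap ∈ nonwanderingSet (coupledHenon a₀ a₁ c) := by
  rw [← nonwanderingSet_symm]
  exact ((Homeomorph.prodComm _ _).mem_nonwanderingSet_iff_of_semiconj
    (semiconj_prodComm_coupledHenon a₀ a₁ c)).2 hp

/-- Orbits entering `X < -R`, `X < -|Z|` escape with decreasing `X`. -/
lemma notMem_nonwanderingSet_of_lt (hA₀ : A₀ = (a₀ + a₁) / 2) (hR1 : 1 ≤ R)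
    (hR : A₀ = R ^ 2 - 2 * R) {p : PhaseSpace} (h1 : (rotatedCoords p).1.1 < -R)
    (h2 : (rotatedCoords p).1.1 < -|(rotatedCoords p).2.1|) :
    p ∉ nonwanderingSet (coupledHenon a₀ a₁ c) := by
  have hφ := rotatedCoords.continuous
  have hstep : ∀ p : PhaseSpace, (rotatedCoords p).1.1 < -R →
      (rotatedCoords p).1.1 < -|(rotatedCoords p).2.1| →
      (rotatedCoords (coupledHenon a₀ a₁ c p)).1.1 < (rotatedCoords p).1.1 := by
    intro p h1 h2
    rw [rotatedCoords_coupledHenon hA₀ rfl]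
    simp only [planarMap, Prod.fst_sub]
    have h3 := neg_abs_le (rotatedCoords p).2.1
    nlinarith [sq_nonneg (rotatedCoords p).1.2]
  refine notMem_nonwanderingSet_of_lyapunov (coupledHenon a₀ a₁ c).continuous
    (N := {p | (rotatedCoords p).1.1 < -R} ∩
      {p | (rotatedCoords p).1.1 < -|(rotatedCoords p).2.1|})
    (L := fun p => (rotatedCoords p).1.1)
    ((isOpen_lt (by fun_prop) continuous_const).inter (isOpen_lt (by fun_prop) (by fun_prop)))
    (fun q hq => ?_) (by fun_prop) (fun q hq => hstep q hq.1 hq.2) ⟨h1, h2⟩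
  have h4 := hstep q hq.1 hq.2
  have h5 : (rotatedCoords q).1.1 < -R := hq.1
  have h6 : (rotatedCoords (coupledHenon a₀ a₁ c q)).2.1 = (rotatedCoords q).1.1 := by
    rw [rotatedCoords_coupledHenon hA₀ rfl]
  refine ⟨h4.trans h5, ?_⟩
  rw [mem_ofPred_eq, h6, abs_of_neg (by linarith), neg_neg]
  exact h4

theorem nonwanderingSet_coupledHenon_subset (hA₀ : A₀ = (a₀ + a₁) / 2) (hR1 : 1 ≤ R)
    (hR : A₀ = R ^ 2 - 2 * R) : nonwanderingSet (coupledHenon a₀ a₁ c) ⊆ boxVF R := by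
  let f := coupledHenon a₀ a₁ c
  have hnext : ∀ p ∈ nonwanderingSet f,
      A₀ - (rotatedCoords p).1.1 ^ 2 - (rotatedCoords p).1.2 ^ 2 - (rotatedCoords p).2.1 < -R →
      -|(rotatedCoords p).1.1| ≤
        A₀ - (rotatedCoords p).1.1 ^ 2 - (rotatedCoords p).1.2 ^ 2 - (rotatedCoords p).2.1 := by
    intro p hp h1
    by_contra! h2
    refine notMem_nonwanderingSet_of_lt (p := f p) hA₀ hR1 hR ?_ ?_
      (f.image_nonwanderingSet ▸ mem_image_of_mem f hp) <;>
    · rw [rotatedCoords_coupledHenon hA₀ rfl]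
      assumption
  have hX : ∀ p ∈ nonwanderingSet f, |(rotatedCoords p).2.1| ≤ |(rotatedCoords p).1.1| →
      |(rotatedCoords p).1.1| ≤ R := by
    intro p hp h1
    by_contra! h2
    have h3 := neg_abs_le (rotatedCoords p).2.1
    have h4 : A₀ - (rotatedCoords p).1.1 ^ 2 - (rotatedCoords p).1.2 ^ 2 - (rotatedCoords p).2.1
        < -|(rotatedCoords p).1.1| := by
      rw [← sq_abs (rotatedCoords p).1.1]
      nlinarith [sq_nonneg (rotatedCoords p).1.2]
    exact absurd (hnext p hp (by linarith)) (not_le.2 h4)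
  have hXZ : ∀ p ∈ nonwanderingSet f,
      |(rotatedCoords p).1.1| ≤ R ∧ |(rotatedCoords p).2.1| ≤ R := by
    intro p hp
    rcases le_total |(rotatedCoords p).2.1| |(rotatedCoords p).1.1| with h | h
    · exact ⟨hX p hp h, h.trans (hX p hp h)⟩
    · have h1 : |(rotatedCoords p).2.1| ≤ R := hX p.swap (swap_mem_nonwanderingSet hp) h
      exact ⟨h.trans h1, h1⟩
  have hY : ∀ p ∈ nonwanderingSet f, |(rotatedCoords p).1.2| ≤ R := by
    intro p hp
    by_contra! h1
    obtain ⟨h2, h3⟩ := hXZ p hp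
    have h4 := (abs_le.1 h3).1
    have h5 : A₀ - (rotatedCoords p).1.1 ^ 2 - (rotatedCoords p).1.2 ^ 2 - (rotatedCoords p).2.1
        < -R := by
      rw [← sq_abs (rotatedCoords p).1.2]
      nlinarith [sq_nonneg (rotatedCoords p).1.1]
    linarith [hnext p hp h5]
  intro p hp
  exact ⟨(hXZ p hp).1, hY p hp, (hXZ p hp).2, hY p.swap (swap_mem_nonwanderingSet hp)⟩

lemma isCompact_nonwanderingSet_coupledHenon (hA₀ : A₀ = (a₀ + a₁) / 2) (hR1 : 1 ≤ R)
    (hR : A₀ = R ^ 2 - 2 * R) : IsCompact (nonwanderingSet (coupledHenon a₀ a₁ c)) :=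
  (isCompact_boxVF R).of_isClosed_subset (isClosed_nonwanderingSet _)
    (nonwanderingSet_coupledHenon_subset hA₀ hR1 hR)

/-! ### The binary horseshoe -/

/-- The part of `V_F ∩ f⁻¹ V_F` in which `X` has the sign prescribed by `i`. -/
def horseshoeLeg (a₀ a₁ c R : ℝ) (i : Bool) : Set PhaseSpace :=
  {p | p ∈ rotatedCoords ⁻¹' (square R ×ˢ square R) ∧
    coupledHenon a₀ a₁ c p ∈ rotatedCoords ⁻¹' (square R ×ˢ square R) ∧
    (rotatedCoords p).1 ∈ halfPlane i}

lemma mem_horseshoeLeg_iff (hA₀ : A₀ = (a₀ + a₁) / 2) (hA₁ : A₁ = (a₀ - a₁) / 2) {i : Bool}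
    {p : PhaseSpace} : p ∈ horseshoeLeg a₀ a₁ c R i ↔
      (rotatedCoords p).1 ∈ square R ∧ (rotatedCoords p).2 ∈ square R ∧
      planarMap A₀ A₁ c (rotatedCoords p).1 - (rotatedCoords p).2 ∈ square R ∧
      (rotatedCoords p).1 ∈ halfPlane i := by
  simp only [horseshoeLeg, mem_ofPred_eq, mem_preimage, rotatedCoords_coupledHenon hA₀ hA₁,
    mem_prod]
  tauto

lemma planarMap_mem_of_mem_horseshoeLeg (hA₀ : A₀ = (a₀ + a₁) / 2) (hA₁ : A₁ = (a₀ - a₁) / 2)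
    {i : Bool} {p : PhaseSpace} (hp : p ∈ horseshoeLeg a₀ a₁ c R i) :
    planarMap A₀ A₁ c (rotatedCoords p).1 ∈ square (2 * R) := by
  obtain ⟨-, h2, h3, -⟩ := (mem_horseshoeLeg_iff hA₀ hA₁).1 hp
  simpa using add_mem_square h3 h2

theorem hasBinaryHorseshoe_coupledHenon {W : ℝ} (hA₀ : A₀ = (a₀ + a₁) / 2)
    (hA₁ : A₁ = (a₀ - a₁) / 2) (hR1 : 1 ≤ R) (h : HorseshoeParams A₀ A₁ c R W) :
    HasBinaryHorseshoe (coupledHenon a₀ a₁ c) rotatedCoords (square R) (square R) := by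
  set f := coupledHenon a₀ a₁ c
  have hsq : IsConnected (square R) :=
    (isConnected_Icc (by linarith)).prod (isConnected_Icc (by linarith))
  choose B hBc hBm hBr hBl using h.exists_inverseBranch
  -- points of a leg are determined by the `(X, Y)` of their image and their own `(Z, W)`
  have hleg : ∀ i, ∀ t ∈ square R, ∀ z ∈ square R, ∀ q,
      (q ∈ horseshoeLeg a₀ a₁ c R i ∧ (rotatedCoords (f q)).1 = t ∧ (rotatedCoords q).2 = z) ↔
        q = rotatedCoords.symm (B i (t + z), z) := by
    intro i t ht z hz q
    refine Iff.trans ?_ rotatedCoords.toEquiv.eq_symm_apply.symm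
    change _ ↔ rotatedCoords q = _
    rw [mem_horseshoeLeg_iff hA₀ hA₁, rotatedCoords_coupledHenon hA₀ hA₁]
    generalize rotatedCoords q = r
    obtain ⟨u, v⟩ := r
    simp only [Prod.mk.injEq]
    constructor
    · rintro ⟨⟨h1, h2, h3, h4⟩, rfl, rfl⟩
      refine ⟨?_, rfl⟩
      rw [sub_add_cancel]
      refine (hBl i u h1 h4 ?_).symm
      simpa using add_mem_square h3 h2
    · rintro ⟨rfl, rfl⟩
      rw [hBr i _ (add_mem_square ht hz), add_sub_cancel_right]
      exact ⟨⟨(hBm i _).1, hz, ht, (hBm i _).2⟩, rfl, rfl⟩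
  have hlegimg : ∀ i, horseshoeLeg a₀ a₁ c R i =
      (fun x : (ℝ × ℝ) × (ℝ × ℝ) => rotatedCoords.symm (B i (x.1 + x.2), x.2)) ''
        (square R ×ˢ square R) := by
    intro i
    ext q
    constructor
    · intro hq
      have hq1 := hq
      obtain ⟨-, h2, -, -⟩ := (mem_horseshoeLeg_iff hA₀ hA₁).1 hq
      have h3 : (rotatedCoords (f q)).1 ∈ square R := hq.2.1.1
      exact ⟨((rotatedCoords (f q)).1, (rotatedCoords q).2), ⟨h3, h2⟩,
        ((hleg i _ h3 _ h2 q).1 ⟨hq, rfl, rfl⟩).symm⟩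
    · rintro ⟨⟨t, z⟩, ⟨ht, hz⟩, rfl⟩
      exact ((hleg i t ht z hz _).2 rfl).1
  have hBcont : ∀ i, Continuous fun x : (ℝ × ℝ) × (ℝ × ℝ) =>
      rotatedCoords.symm (B i (x.1 + x.2), x.2) := fun i =>
    rotatedCoords.symm.continuous.comp
      (((hBc i).comp (continuous_fst.add continuous_snd)).prodMk continuous_snd)
  have hmem : ∀ i q, f q ∈ f '' horseshoeLeg a₀ a₁ c R i ↔ q ∈ horseshoeLeg a₀ a₁ c R i :=
    fun i q => f.injective.mem_set_image
  refine hasBinaryHorseshoe_of_existsUnique (C := fun i => f '' horseshoeLeg a₀ a₁ c R i)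
    hsq.nonempty hsq.nonempty (fun i => ?_) ?_ ?_ (fun i => ?_) (fun i t ht z hz => ?_)
    (isCompact_nonwanderingSet_coupledHenon hA₀ hR1 h.eq) ?_ ?_
  · rw [hlegimg i]
    exact ((((isCompact_square R).prod (isCompact_square R)).image (hBcont i)).image
      f.continuous).isClosed
  · rw [disjoint_image_iff f.injective, disjoint_left]
    intro p hp hp'
    exact h.fst_ne_zero hp.1.1 (planarMap_mem_of_mem_horseshoeLeg hA₀ hA₁ hp)
      (le_antisymm hp.2.2 hp'.2.2)
  · rw [← image_union]
    ext p
    constructor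
    · rintro ⟨hp, q, hq, rfl⟩
      exact ⟨q, (exists_mem_halfPlane (rotatedCoords q).1).imp (⟨hq, hp, ·⟩) (⟨hq, hp, ·⟩), rfl⟩
    · rintro ⟨q, hq | hq, rfl⟩
      · exact ⟨hq.2.1, q, hq.1, rfl⟩
      · exact ⟨hq.2.1, q, hq.1, rfl⟩
  · rw [hlegimg i]
    exact ((hsq.prod hsq).image _ (hBcont i).continuousOn).image _ f.continuous.continuousOn
  · simp only [hmem]
    exact ⟨_, (hleg i t ht z hz _).2 rfl, fun q hq => (hleg i t ht z hz q).1 hq⟩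
  · rw [← boxVF_eq_preimage]
    exact nonwanderingSet_coupledHenon_subset hA₀ hR1 h.eq
  · intro N _ s
    obtain ⟨v, hv⟩ := h.exists_periodic_sequence s
    let P : ZMod N → PhaseSpace := fun m => rotatedCoords.symm (v (m + 1), v m)
    have hfP : ∀ m, f (P m) = P (m + 1) := by
      intro m
      apply rotatedCoords.injective
      rw [rotatedCoords_coupledHenon hA₀ hA₁]
      simp only [P, Homeomorph.apply_symm_apply, (hv (m + 1)).2.2, add_sub_cancel_right]
    have hPC : ∀ m, P m ∈ f '' horseshoeLeg a₀ a₁ c R (s m) := by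
      intro m
      refine ⟨P (m - 1), (mem_horseshoeLeg_iff hA₀ hA₁).2 ?_, by rw [hfP, sub_add_cancel]⟩
      simp only [P, Homeomorph.apply_symm_apply, sub_add_cancel, (hv m).2.2, add_sub_cancel_right]
      exact ⟨(hv _).1, (hv _).1, (hv _).1, (hv m).2.1⟩
    have hzpow : ∀ n : ℤ, (f ^ n) (P 0) = P n := by
      intro n
      induction n using Int.induction_on with
      | zero => simp
      | succ k ih =>
        have h1 : (f ^ ((k : ℤ) + 1)) (P 0) = f ((f ^ (k : ℤ)) (P 0)) := by
          rw [zpow_add_one, (Commute.zpow_self f _).eq]; rfl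
        rw [h1, ih, hfP]
        push_cast
        rfl
      | pred k ih =>
        apply f.injective
        have h1 : f ((f ^ (-(k : ℤ) - 1)) (P 0)) = (f ^ (-(k : ℤ))) (P 0) := by
          conv_rhs => rw [show -(k : ℤ) = 1 + (-(k : ℤ) - 1) by ring, zpow_one_add]
          rfl
        rw [h1, ih, hfP]
        push_cast
        rw [sub_add_cancel]
    refine ⟨P 0, ?_, fun n => ?_⟩
    · have h1 : ∀ k : ℕ, f^[k] (P 0) = P k := by
        intro k
        induction k with
        | zero => simp
        | succ k ih => rw [Function.iterate_succ_apply', ih, hfP]; push_cast; rfl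
      rw [h1, ZMod.natCast_self]
    · rw [hzpow]
      exact hPC _

end CoupledHenon

/-! ### Hyperbolicity of second-order recurrences -/

section DelayMap

variable {V F : Type*} [NormedAddCommGroup V] [NormedSpace ℝ V] [NormedAddCommGroup F]
  [NormedSpace ℝ F]

/-- The first-order form `(u, v) ↦ (g u - v, u)` of the second-order recurrence
`uₙ₊₁ + uₙ₋₁ = g uₙ`. -/
def delayMap (g : V → V) (p : V × V) : V × V := (g p.1 - p.2, p.1)

variable {g : V → V}

lemma contDiff_delayMap (hg : ContDiff ℝ 1 g) : ContDiff ℝ 1 (delayMap g) :=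
  ((hg.comp contDiff_fst).sub contDiff_snd).prodMk contDiff_fst

lemma contDiff_iterate_delayMap (hg : ContDiff ℝ 1 g) (n : ℕ) : ContDiff ℝ 1 (delayMap g)^[n] := by
  induction n with
  | zero => exact contDiff_id
  | succ n ih =>
    rw [Function.iterate_succ']
    exact (contDiff_delayMap hg).comp ih

lemma fderiv_delayMap (hg : ContDiff ℝ 1 g) (p w : V × V) :
    fderiv ℝ (delayMap g) p w = (fderiv ℝ g p.1 w.1 - w.2, w.1) := by
  have h1 : HasFDerivAt g (fderiv ℝ g p.1) p.1 :=
    (hg.differentiable one_ne_zero p.1).hasFDerivAt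
  have h2 : HasFDerivAt (delayMap g) (((fderiv ℝ g p.1).comp (ContinuousLinearMap.fst ℝ V V)
      - ContinuousLinearMap.snd ℝ V V).prod (ContinuousLinearMap.fst ℝ V V)) p :=
    ((h1.comp p hasFDerivAt_fst).sub hasFDerivAt_snd).prodMk hasFDerivAt_fst
  rw [h2.fderiv]
  rfl

lemma fderiv_iterate_delayMap_succ (hg : ContDiff ℝ 1 g) (n : ℕ) (p w : V × V) :
    fderiv ℝ (delayMap g)^[n + 1] p w =
      fderiv ℝ (delayMap g)^[n] (delayMap g p) (fderiv ℝ (delayMap g) p w) := by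
  rw [Function.iterate_succ, fderiv_comp _
    ((contDiff_iterate_delayMap hg n).differentiable one_ne_zero _)
    ((contDiff_delayMap hg).differentiable one_ne_zero _)]
  rfl

variable (g) in
/-- The stable subspace at `p`: the tangent vectors whose forward orbit under the derivative stays
bounded. -/
def stableSpace (p : V × V) : Submodule ℝ (V × V) where
  carrier := {w | ∃ C, ∀ n, ‖(fderiv ℝ (delayMap g)^[n] p w).1‖ ≤ C}
  zero_mem' := ⟨0, fun n => by simp⟩
  add_mem' := by
    rintro w w' ⟨C, hC⟩ ⟨C', hC'⟩
    refine ⟨C + C', fun n => ?_⟩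
    rw [map_add]
    exact (norm_add_le _ _).trans (add_le_add (hC n) (hC' n))
  smul_mem' := by
    rintro r w ⟨C, hC⟩
    refine ⟨‖r‖ * C, fun n => ?_⟩
    rw [map_smul, Prod.smul_fst, norm_smul]
    exact mul_le_mul_of_nonneg_left (hC n) (norm_nonneg r)

variable (g) in
/-- The unstable subspace at `p`, obtained from the stable one by the time reversal
`(u, v) ↦ (v, u)`. -/
def unstableSpace (p : V × V) : Submodule ℝ (V × V) :=
  (stableSpace g p.swap).comap (LinearEquiv.prodComm ℝ V V).toLinearMap

lemma mem_unstableSpace {p w : V × V} : w ∈ unstableSpace g p ↔ w.swap ∈ stableSpace g p.swap :=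
  Iff.rfl

lemma mem_stableSpace_iff_fderiv (hg : ContDiff ℝ 1 g) {p w : V × V} :
    w ∈ stableSpace g p ↔ fderiv ℝ (delayMap g) p w ∈ stableSpace g (delayMap g p) := by
  constructor
  · rintro ⟨C, hC⟩
    exact ⟨C, fun n => by rw [← fderiv_iterate_delayMap_succ hg]; exact hC _⟩
  · rintro ⟨C, hC⟩
    refine ⟨max C ‖w.1‖, fun n => ?_⟩
    rcases n with _ | n
    · simp
    · rw [fderiv_iterate_delayMap_succ hg]
      exact (hC n).trans (le_max_left _ _)

lemma mem_unstableSpace_iff_fderiv (hg : ContDiff ℝ 1 g) {p w : V × V} :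
    w ∈ unstableSpace g p ↔ fderiv ℝ (delayMap g) p w ∈ unstableSpace g (delayMap g p) := by
  rw [mem_unstableSpace, mem_unstableSpace,
    mem_stableSpace_iff_fderiv hg (p := (delayMap g p).swap), fderiv_delayMap hg,
    fderiv_delayMap hg]
  simp [delayMap, Prod.swap]

lemma surjective_fderiv_delayMap (hg : ContDiff ℝ 1 g) (p : V × V) :
    Function.Surjective (fderiv ℝ (delayMap g) p) := fun w =>
  ⟨(w.2, fderiv ℝ g p.1 w.2 - w.1), by rw [fderiv_delayMap hg]; simp⟩

lemma map_fderiv_stableSpace (hg : ContDiff ℝ 1 g) (p : V × V) :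
    (stableSpace g p).map (fderiv ℝ (delayMap g) p).toLinearMap
      = stableSpace g (delayMap g p) := by
  ext w
  constructor
  · rintro ⟨w, hw, rfl⟩
    exact (mem_stableSpace_iff_fderiv hg).1 hw
  · intro hw
    obtain ⟨w, rfl⟩ := surjective_fderiv_delayMap hg p w
    exact ⟨w, (mem_stableSpace_iff_fderiv hg).2 hw, rfl⟩

lemma map_fderiv_unstableSpace (hg : ContDiff ℝ 1 g) (p : V × V) :
    (unstableSpace g p).map (fderiv ℝ (delayMap g) p).toLinearMap
      = unstableSpace g (delayMap g p) := by
  ext w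
  constructor
  · rintro ⟨w, hw, rfl⟩
    exact (mem_unstableSpace_iff_fderiv hg).1 hw
  · intro hw
    obtain ⟨w, rfl⟩ := surjective_fderiv_delayMap hg p w
    exact ⟨w, (mem_unstableSpace_iff_fderiv hg).2 hw, rfl⟩

/-- The derivative of `g` expands an adapted norm `‖e ·‖` by a factor `μ > 2` over the invariant
set `Λ`. The factor `2` is what it takes to dominate the two neighbours in the recurrence
`uₙ₊₁ + uₙ₋₁ = Dg uₙ`. -/
structure IsDelayExpanding (g : V → V) (e : V ≃L[ℝ] F) (Λ : Set (V × V)) (μ : ℝ) : Prop where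
  contDiff : ContDiff ℝ 1 g
  mapsTo : MapsTo (delayMap g) Λ Λ
  two_lt : 2 < μ
  expands : ∀ p ∈ Λ, ∀ v, μ * ‖e v‖ ≤ ‖e (fderiv ℝ g p.1 v)‖

namespace IsDelayExpanding

variable {e : V ≃L[ℝ] F} {Λ : Set (V × V)} {μ : ℝ} (h : IsDelayExpanding g e Λ μ)
include h

lemma expands_sub {p : V × V} (hp : p ∈ Λ) (w : V × V) :
    μ * ‖e w.1‖ ≤ ‖e (fderiv ℝ (delayMap g) p w).1‖ + ‖e w.2‖ := by
  rw [fderiv_delayMap h.contDiff]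
  refine (h.expands p hp w.1).trans ?_
  have := norm_add_le (e (fderiv ℝ g p.1 w.1 - w.2)) (e w.2)
  rwa [← map_add, sub_add_cancel] at this

/-- Tangent vectors in the cone `‖v‖ ≤ ‖u‖` stay in the cone and grow exponentially. -/
lemma growth_of_mem_cone {p : V × V} (hp : p ∈ Λ) {w : V × V} (hw : ‖e w.2‖ ≤ ‖e w.1‖) (n : ℕ) :
    (μ - 1) ^ n * ‖e w.1‖ ≤ ‖e (fderiv ℝ (delayMap g)^[n] p w).1‖ := by
  induction n generalizing p w with
  | zero => simp
  | succ n ih =>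
    have h1 := h.expands_sub hp w
    have h2 : (μ - 1) * ‖e w.1‖ ≤ ‖e (fderiv ℝ (delayMap g) p w).1‖ := by linarith
    have h3 : (fderiv ℝ (delayMap g) p w).2 = w.1 := by rw [fderiv_delayMap h.contDiff]
    have h4 : (0 : ℝ) ≤ (μ - 1) ^ n := pow_nonneg (by linarith [h.two_lt]) n
    rw [fderiv_iterate_delayMap_succ h.contDiff, pow_succ, mul_assoc]
    refine (mul_le_mul_of_nonneg_left h2 h4).trans (ih (h.mapsTo hp) ?_)
    rw [h3]
    nlinarith [h.two_lt, norm_nonneg (e w.1)]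

lemma le_of_mem_stableSpace {p : V × V} (hp : p ∈ Λ) {w : V × V} (hw : w ∈ stableSpace g p) :
    ‖e w.1‖ ≤ ‖e w.2‖ := by
  obtain ⟨C, hC⟩ := hw
  by_contra! hlt
  have hpos : 0 < ‖e w.1‖ := (norm_nonneg _).trans_lt hlt
  obtain ⟨n, hn⟩ := pow_unbounded_of_one_lt (‖(e : V →L[ℝ] F)‖ * C / ‖e w.1‖)
    (by linarith [h.two_lt] : 1 < μ - 1)
  rw [div_lt_iff₀ hpos] at hn
  have h1 := h.growth_of_mem_cone hp hlt.le n
  have h2 := (e : V →L[ℝ] F).le_opNorm (fderiv ℝ (delayMap g)^[n] p w).1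
  have h3 := mul_le_mul_of_nonneg_left (hC n) (norm_nonneg (e : V →L[ℝ] F))
  exact absurd (hn.trans_le (h1.trans (h2.trans h3))) (lt_irrefl _)

lemma contraction_of_mem_stableSpace {p : V × V} (hp : p ∈ Λ) {w : V × V}
    (hw : w ∈ stableSpace g p) : ‖e w.1‖ ≤ (μ - 1)⁻¹ * ‖e w.2‖ := by
  have h1 := h.le_of_mem_stableSpace (h.mapsTo hp) ((mem_stableSpace_iff_fderiv h.contDiff).1 hw)
  have h2 := h.expands_sub hp w
  have h3 : (fderiv ℝ (delayMap g) p w).2 = w.1 := by rw [fderiv_delayMap h.contDiff]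
  rw [h3] at h1
  rw [inv_mul_eq_div, le_div_iff₀ (by linarith [h.two_lt])]
  linarith

lemma norm_iterate_le_of_mem_stableSpace {p : V × V} (hp : p ∈ Λ) {w : V × V}
    (hw : w ∈ stableSpace g p) (n : ℕ) :
    ‖e (fderiv ℝ (delayMap g)^[n] p w).1‖ ≤ (μ - 1)⁻¹ ^ n * ‖e w.2‖ ∧
      ‖e (fderiv ℝ (delayMap g)^[n] p w).2‖ ≤ (μ - 1)⁻¹ ^ n * ‖e w.2‖ := by
  have hr0 : 0 ≤ (μ - 1)⁻¹ := inv_nonneg.2 (by linarith [h.two_lt])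
  have hr1 : (μ - 1)⁻¹ ≤ 1 := inv_le_one_of_one_le₀ (by linarith [h.two_lt])
  induction n generalizing p w with
  | zero => simpa using h.le_of_mem_stableSpace hp hw
  | succ n ih =>
    rw [fderiv_iterate_delayMap_succ h.contDiff]
    have h1 := ih (h.mapsTo hp) ((mem_stableSpace_iff_fderiv h.contDiff).1 hw)
    have h2 : (fderiv ℝ (delayMap g) p w).2 = w.1 := by rw [fderiv_delayMap h.contDiff]
    rw [h2] at h1
    have h3 : (μ - 1)⁻¹ ^ n * ‖e w.1‖ ≤ (μ - 1)⁻¹ ^ (n + 1) * ‖e w.2‖ := by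
      rw [pow_succ, mul_assoc]
      exact mul_le_mul_of_nonneg_left (h.contraction_of_mem_stableSpace hp hw)
        (pow_nonneg hr0 n)
    exact ⟨h1.1.trans h3, h1.2.trans h3⟩

lemma norm_fderiv_iterate_le {p : V × V} (hp : p ∈ Λ) {w : V × V} (hw : w ∈ stableSpace g p)
    (n : ℕ) : ‖fderiv ℝ (delayMap g)^[n] p w‖ ≤
      (‖(e.symm : F →L[ℝ] V)‖ * ‖(e : V →L[ℝ] F)‖ + 1) * (μ - 1)⁻¹ ^ n * ‖w‖ := by
  obtain ⟨h1, h2⟩ := h.norm_iterate_le_of_mem_stableSpace hp hw n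
  have hr0 : 0 ≤ (μ - 1)⁻¹ ^ n := pow_nonneg (inv_nonneg.2 (by linarith [h.two_lt])) n
  have key : ∀ v : V, ‖e v‖ ≤ (μ - 1)⁻¹ ^ n * ‖e w.2‖ → ‖v‖ ≤
      (‖(e.symm : F →L[ℝ] V)‖ * ‖(e : V →L[ℝ] F)‖ + 1) * (μ - 1)⁻¹ ^ n * ‖w‖ := by
    intro v hv
    have h3 : ‖v‖ ≤ ‖(e.symm : F →L[ℝ] V)‖ * ‖e v‖ := by
      simpa using (e.symm : F →L[ℝ] V).le_opNorm (e v)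
    have h4 : ‖e w.2‖ ≤ ‖(e : V →L[ℝ] F)‖ * ‖w‖ :=
      ((e : V →L[ℝ] F).le_opNorm w.2).trans
        (mul_le_mul_of_nonneg_left (norm_snd_le w) (norm_nonneg _))
    have h5 : 0 ≤ (μ - 1)⁻¹ ^ n * ‖w‖ := mul_nonneg hr0 (norm_nonneg w)
    calc ‖v‖ ≤ ‖(e.symm : F →L[ℝ] V)‖ * ((μ - 1)⁻¹ ^ n * (‖(e : V →L[ℝ] F)‖ * ‖w‖)) :=
          h3.trans (by gcongr; exact hv.trans (by gcongr))
      _ ≤ _ := by nlinarith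
  exact max_le (key _ h1) (key _ h2)

variable [FiniteDimensional ℝ V]

/-- A two-point boundary value problem for the linearized recurrence is solvable, and the solution
stays in the ball of the initial value. -/
lemma exists_bounded_upTo {p : V × V} (hp : p ∈ Λ) (b : V) (n : ℕ) :
    ∃ a, ∀ j ≤ n, ‖e (fderiv ℝ (delayMap g)^[j] p (a, b)).1‖ ≤ ‖e b‖ := by
  let T : V →ₗ[ℝ] V := LinearMap.fst ℝ V V ∘ₗ (fderiv ℝ (delayMap g)^[n] p).toLinearMap ∘ₗ
    LinearMap.inl ℝ V V
  have hT : Function.Injective T := by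
    refine (injective_iff_map_eq_zero T).2 fun a ha => ?_
    have h1 := h.growth_of_mem_cone hp (w := (a, 0)) (by simp) n
    have h2 : (fderiv ℝ (delayMap g)^[n] p (a, 0)).1 = 0 := ha
    rw [h2, map_zero, norm_zero] at h1
    have h3 : 0 < (μ - 1) ^ n := pow_pos (by linarith [h.two_lt]) n
    have h4 : ‖e a‖ ≤ 0 := by
      by_contra! hcon
      exact absurd h1 (not_le.2 (mul_pos h3 hcon))
    simpa using h4
  obtain ⟨a, ha⟩ := (LinearMap.injective_iff_surjective.1 hT)
    (-(fderiv ℝ (delayMap g)^[n] p (0, b)).1)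
  have hzero : (fderiv ℝ (delayMap g)^[n] p (a, b)).1 = 0 := by
    have h1 : ((a, b) : V × V) = (a, 0) + (0, b) := by simp
    rw [h1, map_add, Prod.fst_add]
    exact add_eq_zero_iff_eq_neg.2 ha
  -- a solution vanishing at a later time lies outside the expanding cone
  have hcone : ∀ j, ∀ q ∈ Λ, ∀ w : V × V, (fderiv ℝ (delayMap g)^[j] q w).1 = 0 →
      ‖e w.1‖ ≤ ‖e w.2‖ := by
    intro j q hq w hw
    by_contra! hlt
    have h1 := h.growth_of_mem_cone hq hlt.le j
    rw [hw, map_zero, norm_zero] at h1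
    exact absurd h1 (not_le.2 (mul_pos (pow_pos (by linarith [h.two_lt]) j)
      ((norm_nonneg _).trans_lt hlt)))
  have hind : ∀ m, ∀ q ∈ Λ, ∀ w : V × V, (fderiv ℝ (delayMap g)^[m] q w).1 = 0 → ∀ j ≤ m,
      ‖e (fderiv ℝ (delayMap g)^[j] q w).1‖ ≤ ‖e w.2‖ := by
    intro m
    induction m with
    | zero =>
      intro q hq w hw j hj
      rw [Nat.le_zero.1 hj, hw]
      simp
    | succ m ih =>
      intro q hq w hw j hj
      have h1 := hcone (m + 1) q hq w hw
      rcases j with _ | j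
      · simpa using h1
      · rw [fderiv_iterate_delayMap_succ h.contDiff] at hw ⊢
        refine (ih _ (h.mapsTo hq) _ hw j (Nat.le_of_succ_le_succ hj)).trans ?_
        rwa [fderiv_delayMap h.contDiff]
  exact ⟨a, hind n p hp (a, b) hzero⟩

lemma exists_mem_stableSpace {p : V × V} (hp : p ∈ Λ) (b : V) : ∃ a, (a, b) ∈ stableSpace g p := by
  let K : ℕ → Set V := fun k =>
    ⋂ j ∈ Iic k, {a | ‖e (fderiv ℝ (delayMap g)^[j] p (a, b)).1‖ ≤ ‖e b‖}
  have hKc : ∀ k, IsClosed (K k) := fun k => isClosed_biInter fun j _ =>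
    isClosed_le (by fun_prop) continuous_const
  have hK0 : IsCompact (K 0) := by
    refine (isCompact_closedBall (0 : V) (‖(e.symm : F →L[ℝ] V)‖ * ‖e b‖)).of_isClosed_subset
      (hKc 0) fun a ha => ?_
    have h1 : ‖e a‖ ≤ ‖e b‖ := by simpa using mem_iInter₂.1 ha 0 (mem_Iic.2 le_rfl)
    have h2 : ‖a‖ ≤ ‖(e.symm : F →L[ℝ] V)‖ * ‖e a‖ := by
      simpa using (e.symm : F →L[ℝ] V).le_opNorm (e a)
    rw [mem_closedBall_zero_iff]
    exact h2.trans (by gcongr)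
  obtain ⟨a, ha⟩ := IsCompact.nonempty_iInter_of_sequence_nonempty_isCompact_isClosed K
    (fun k => biInter_subset_biInter_left (Iic_subset_Iic.2 k.le_succ))
    (fun k => (h.exists_bounded_upTo hp b k).imp fun a ha => mem_iInter₂.2 ha) hK0 hKc
  refine ⟨a, ‖(e.symm : F →L[ℝ] V)‖ * ‖e b‖, fun n => ?_⟩
  have h1 : ‖e (fderiv ℝ (delayMap g)^[n] p (a, b)).1‖ ≤ ‖e b‖ :=
    mem_iInter₂.1 (mem_iInter.1 ha n) n (mem_Iic.2 le_rfl)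
  have h2 := (e.symm : F →L[ℝ] V).le_opNorm (e (fderiv ℝ (delayMap g)^[n] p (a, b)).1)
  rw [ContinuousLinearEquiv.coe_coe, ContinuousLinearEquiv.symm_apply_apply] at h2
  exact h2.trans (by gcongr)

lemma isCompl_stableSpace_unstableSpace {p : V × V} (hp : p ∈ Λ) (hp' : p.swap ∈ Λ) :
    IsCompl (stableSpace g p) (unstableSpace g p) := by
  refine (Submodule.isCompl_iff_disjoint _ _ ?_).2 (Submodule.disjoint_def.2 fun w hw hw' => ?_)
  · have h1 : Module.finrank ℝ V ≤ Module.finrank ℝ (stableSpace g p) := by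
      refine LinearMap.finrank_le_finrank_of_surjective
        (f := LinearMap.snd ℝ V V ∘ₗ (stableSpace g p).subtype) fun b => ?_
      obtain ⟨a, ha⟩ := h.exists_mem_stableSpace hp b
      exact ⟨⟨_, ha⟩, rfl⟩
    have h2 : Module.finrank ℝ V ≤ Module.finrank ℝ (unstableSpace g p) := by
      refine LinearMap.finrank_le_finrank_of_surjective
        (f := LinearMap.fst ℝ V V ∘ₗ (unstableSpace g p).subtype) fun b => ?_
      obtain ⟨a, ha⟩ := h.exists_mem_stableSpace hp' b
      exact ⟨⟨(b, a), ha⟩, rfl⟩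
    rw [Module.finrank_prod]
    exact add_le_add h1 h2
  · have h1 := h.contraction_of_mem_stableSpace hp hw
    have h2 : ‖e w.2‖ ≤ (μ - 1)⁻¹ * ‖e w.1‖ := h.contraction_of_mem_stableSpace hp' hw'
    have h3 : (μ - 1)⁻¹ < 1 := inv_lt_one_of_one_lt₀ (by linarith [h.two_lt])
    have h4 : ‖e w.1‖ ≤ 0 := by nlinarith [norm_nonneg (e w.1), norm_nonneg (e w.2)]
    have h5 : ‖e w.2‖ ≤ 0 := by nlinarith [norm_nonneg (e w.1), norm_nonneg (e w.2)]
    exact Prod.ext (by simpa using h4) (by simpa using h5)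

/-- The set `Λ` is uniformly hyperbolic if it is also invariant under time reversal. -/
theorem isUniformlyHyperbolic {f : V × V ≃ₜ V × V} (hf : ⇑f = delayMap g)
    (hfs : ⇑f.symm = Prod.swap ∘ delayMap g ∘ Prod.swap) (hΛ : IsCompact Λ) (hinv : f '' Λ = Λ)
    (hswap : ∀ p ∈ Λ, p.swap ∈ Λ) : IsUniformlyHyperbolic f Λ := by
  have hsw : ContDiff ℝ 1 (Prod.swap : V × V → V × V) := contDiff_snd.prodMk contDiff_fst
  have hiter : ∀ n, f.symm^[n] = Prod.swap ∘ (delayMap g)^[n] ∘ Prod.swap := by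
    intro n
    have h1 : Function.Semiconj Prod.swap (delayMap g) f.symm := fun p => by simp [hfs]
    funext p
    rw [Function.comp_apply, Function.comp_apply, (h1.iterate_right n).eq, Prod.swap_swap]
  have hderiv : ∀ n p w, fderiv ℝ (f.symm^[n]) p w =
      (fderiv ℝ (delayMap g)^[n] p.swap w.swap).swap := by
    intro n p w
    have h1 : HasFDerivAt (delayMap g)^[n] (fderiv ℝ (delayMap g)^[n] p.swap) p.swap :=
      ((contDiff_iterate_delayMap h.contDiff n).differentiable one_ne_zero _).hasFDerivAt
    let s := ContinuousLinearEquiv.prodComm ℝ V V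
    have h2 : ∀ q, HasFDerivAt (Prod.swap : V × V → V × V) (s : V × V →L[ℝ] V × V) q :=
      fun q => s.hasFDerivAt
    rw [hiter, ((h2 _).comp p (h1.comp p (h2 p))).fderiv]
    rfl
  have hr : (1 : ℝ) < μ - 1 := by linarith [h.two_lt]
  have hK : 0 < ‖(e.symm : F →L[ℝ] V)‖ * ‖(e : V →L[ℝ] F)‖ + 1 := by positivity
  refine ⟨hf ▸ contDiff_delayMap h.contDiff,
    hfs ▸ hsw.comp ((contDiff_delayMap h.contDiff).comp hsw), hΛ, hinv,
    stableSpace g, unstableSpace g, fun p hp => ⟨?_, ?_, ?_⟩,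
    ‖(e.symm : F →L[ℝ] V)‖ * ‖(e : V →L[ℝ] F)‖ + 1, (μ - 1)⁻¹, hK,
    inv_pos.2 (by linarith), inv_lt_one_of_one_lt₀ hr, fun p hp n v hv => ?_,
    fun p hp n v hv => ?_⟩
  · exact h.isCompl_stableSpace_unstableSpace hp (hswap p hp)
  · rw [hf]
    exact map_fderiv_stableSpace h.contDiff p
  · rw [hf]
    exact map_fderiv_unstableSpace h.contDiff p
  · rw [hf]
    exact h.norm_fderiv_iterate_le hp hv n
  · have hn : ∀ w : V × V, ‖w.swap‖ = ‖w‖ := fun w => max_comm _ _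
    rw [hderiv, hn, ← hn v]
    exact h.norm_fderiv_iterate_le (hswap p hp) hv n

end IsDelayExpanding
end DelayMap

/-! ### Hyperbolicity of the coupled Hénon map -/

section CoupledHenonHyperbolic

variable {a₀ a₁ c A₀ A₁ R : ℝ}

/-- The nonlinearity of the coupled Hénon map in the original coordinates. -/
def henonNonlinearity (a₀ a₁ c : ℝ) (u : ℝ × ℝ) : ℝ × ℝ :=
  (a₀ - u.1 ^ 2 + c * (u.1 - u.2), a₁ - u.2 ^ 2 - c * (u.1 - u.2))

lemma coe_coupledHenon (a₀ a₁ c : ℝ) :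
    ⇑(coupledHenon a₀ a₁ c) = delayMap (henonNonlinearity a₀ a₁ c) := by
  funext p
  simp only [coupledHenon, delayMap, henonNonlinearity, Homeomorph.homeomorph_mk_coe,
    Equiv.coe_fn_mk, Prod.ext_iff, Prod.fst_sub, Prod.snd_sub, and_true]
  constructor <;> ring

lemma contDiff_henonNonlinearity (a₀ a₁ c : ℝ) : ContDiff ℝ 1 (henonNonlinearity a₀ a₁ c) := by
  unfold henonNonlinearity; fun_prop

lemma fderiv_henonNonlinearity (a₀ a₁ c : ℝ) (u v : ℝ × ℝ) :
    fderiv ℝ (henonNonlinearity a₀ a₁ c) u v =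
      (-2 * u.1 * v.1 + c * (v.1 - v.2), -2 * u.2 * v.2 - c * (v.1 - v.2)) := by
  have h1 : HasFDerivAt (fun u : ℝ × ℝ => u.1) (ContinuousLinearMap.fst ℝ ℝ ℝ) u := hasFDerivAt_fst
  have h2 : HasFDerivAt (fun u : ℝ × ℝ => u.2) (ContinuousLinearMap.snd ℝ ℝ ℝ) u := hasFDerivAt_snd
  have h3 := (((h1.pow 2).const_sub a₀).add ((h1.sub h2).const_mul c)).prodMk
    (((h2.pow 2).const_sub a₁).sub ((h1.sub h2).const_mul c))
  have h4 : HasFDerivAt (henonNonlinearity a₀ a₁ c) _ u := h3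
  rw [h4.fderiv]
  simp

/-- By Cauchy–Schwarz, a lower bound for the pairing of an image vector `(s, t)` with `(a, b)` makes
it longer than `(a, b)`. A sign flip of one coordinate adapts this to indefinite matrices. -/
lemma sq_le_of_pairing {μ a b s t : ℝ} (hμ : 0 ≤ μ)
    (h : μ * (a ^ 2 + b ^ 2) ≤ s * a + t * b) : μ ^ 2 * (a ^ 2 + b ^ 2) ≤ s ^ 2 + t ^ 2 := by
  rcases (by positivity : 0 ≤ a ^ 2 + b ^ 2).eq_or_lt with h0 | h0
  · rw [← h0, mul_zero]
    positivity
  · have h1 : (μ * (a ^ 2 + b ^ 2)) ^ 2 ≤ (s * a + t * b) ^ 2 := by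
      gcongr
    have h2 : (s * a + t * b) ^ 2 ≤ (s ^ 2 + t ^ 2) * (a ^ 2 + b ^ 2) := by
      nlinarith [sq_nonneg (s * b - t * a)]
    refine le_of_mul_le_mul_right ?_ h0
    nlinarith

/-- Where `X ≥ m`, `X ≤ c - m`, or `X ≤ -(|Y| + m)`, the derivative of the nonlinearity expands the
Euclidean norm by the factor `2 m`. In rotated coordinates it is the symmetric matrix with rows
`(-2X, -2Y)` and `(-2Y, 2(c - X))`, indefinite in the first case and definite in the second. -/
lemma expands_henonNonlinearity {m : ℝ} (hm : 0 ≤ m) (hc : 0 < c) (u v : ℝ × ℝ)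
    (hu : (m ≤ (u.1 + u.2) / 2 ∧ m ≤ c - (u.1 + u.2) / 2) ∨
      |(u.1 - u.2) / 2| + m ≤ -((u.1 + u.2) / 2)) :
    2 * m * ‖Complex.equivRealProdCLM.symm v‖ ≤
      ‖Complex.equivRealProdCLM.symm (fderiv ℝ (henonNonlinearity a₀ a₁ c) u v)‖ := by
  refine le_of_sq_le_sq ?_ (norm_nonneg _)
  rw [mul_pow, Complex.sq_norm, Complex.sq_norm, fderiv_henonNonlinearity]
  simp only [Complex.normSq_apply, Complex.equivRealProdCLM_symm_apply_re,
    Complex.equivRealProdCLM_symm_apply_im]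
  obtain ⟨X, hX⟩ : ∃ X, X = (u.1 + u.2) / 2 := ⟨_, rfl⟩
  obtain ⟨Y, hY⟩ : ∃ Y, Y = (u.1 - u.2) / 2 := ⟨_, rfl⟩
  obtain ⟨a, ha⟩ : ∃ a, a = (v.1 + v.2) / 2 := ⟨_, rfl⟩
  obtain ⟨b, hb⟩ : ∃ b, b = (v.1 - v.2) / 2 := ⟨_, rfl⟩
  rw [← hX, ← hY] at hu
  have hu1 : u.1 = X + Y := by linarith
  have hu2 : u.2 = X - Y := by linarith
  have hv1 : v.1 = a + b := by linarith
  have hv2 : v.2 = a - b := by linarith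
  rw [hu1, hu2, hv1, hv2]
  have key : (2 * m) ^ 2 * (a ^ 2 + b ^ 2) ≤
      (-2 * X * a - 2 * Y * b) ^ 2 + (-2 * Y * a + 2 * (c - X) * b) ^ 2 := by
    rcases hu with ⟨h1, h2⟩ | h1
    · have h3 := sq_le_of_pairing (μ := 2 * m) (a := a) (b := b) (s := -(-2 * X * a - 2 * Y * b))
        (t := -2 * Y * a + 2 * (c - X) * b) (by linarith)
        (by nlinarith [mul_le_mul_of_nonneg_right h1 (sq_nonneg a),
          mul_le_mul_of_nonneg_right h2 (sq_nonneg b)])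
      rwa [neg_sq] at h3
    · have h4 := le_abs_self Y
      have h5 := neg_abs_le Y
      refine sq_le_of_pairing (by linarith) ?_
      -- the mixed term is bounded by `2 |Y| (a ^ 2 + b ^ 2)`
      nlinarith [mul_le_mul_of_nonneg_right h1 (sq_nonneg a),
        mul_le_mul_of_nonneg_right h1 (sq_nonneg b), mul_nonneg hc.le (sq_nonneg b),
        mul_nonneg (by linarith : 0 ≤ |Y| - Y) (sq_nonneg (a + b)),
        mul_nonneg (by linarith : 0 ≤ |Y| + Y) (sq_nonneg (a - b))]
  nlinarith [key]

theorem isUniformlyHyperbolic_coupledHenon {W Z : ℝ} (hA₀ : A₀ = (a₀ + a₁) / 2)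
    (hA₁ : A₁ = (a₀ - a₁) / 2) (hR1 : 1 ≤ R) (h : HorseshoeParams A₀ A₁ c R W)
    (hZ : Z = √(A₀ - W ^ 2 - 2 * R)) (hZW : 4 ≤ Z - W) :
    IsUniformlyHyperbolic (coupledHenon a₀ a₁ c) (nonwanderingSet (coupledHenon a₀ a₁ c)) := by
  have hW := h.nonneg
  have hR := h.pos
  have hZsq : Z ^ 2 = A₀ - W ^ 2 - 2 * R := by
    rw [hZ, Real.sq_sqrt]
    linarith [h.gap]
  have hZR : Z < R := by
    rw [h.eq] at hZsq
    nlinarith [sq_nonneg W]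
  have hcR : 1 < c - R := by
    by_contra! hle
    nlinarith [h.bound, abs_nonneg A₁]
  have hm : 1 < min 4 (c - R) := lt_min (by norm_num) hcR
  have himg := (coupledHenon a₀ a₁ c).image_nonwanderingSet
  have hbox := nonwanderingSet_coupledHenon_subset (c := c) hA₀ hR1 h.eq
  rw [boxVF_eq_preimage] at hbox
  have hexp : IsDelayExpanding (henonNonlinearity a₀ a₁ c) Complex.equivRealProdCLM.symm
      (nonwanderingSet (coupledHenon a₀ a₁ c)) (2 * min 4 (c - R)) := by
    refine ⟨contDiff_henonNonlinearity _ _ _, ?_, by linarith, fun p hp v => ?_⟩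
    · rw [← coe_coupledHenon]
      exact mapsTo_iff_image_subset.2 himg.subset
    · have hu : (rotatedCoords p).1 ∈ square R := (hbox hp).1
      have hfp := hbox (himg ▸ mem_image_of_mem _ hp)
      rw [mem_preimage, rotatedCoords_coupledHenon hA₀ hA₁] at hfp
      have hG : planarMap A₀ A₁ c (rotatedCoords p).1 ∈ square (2 * R) := by
        simpa using add_mem_square hfp.1 (hbox hp).2
      have hY : |(p.1.1 - p.1.2) / 2| ≤ W := h.abs_snd_le hu hG
      have hX : Z ^ 2 ≤ ((p.1.1 + p.1.2) / 2) ^ 2 := hZsq ▸ h.sq_fst_ge hu hG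
      have hXR : (p.1.1 + p.1.2) / 2 ≤ R := (abs_le.1 (mem_square.1 hu).1).2
      have hXZ : Z ≤ |(p.1.1 + p.1.2) / 2| := by
        rw [← abs_of_nonneg (by linarith : 0 ≤ Z)]
        exact sq_le_sq.1 hX
      refine expands_henonNonlinearity (by linarith) (hR.trans h.lt) p.1 v ?_
      rcases le_abs.1 hXZ with h1 | h1
      · exact Or.inl ⟨(min_le_left _ _).trans (by linarith), (min_le_right _ _).trans (by linarith)⟩
      · exact Or.inr (by linarith [min_le_left 4 (c - R)])
  exact hexp.isUniformlyHyperbolic (coe_coupledHenon _ _ _)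
    (by rw [← coe_coupledHenon]; rfl) (isCompact_nonwanderingSet_coupledHenon hA₀ hR1 h.eq) himg
    fun p hp => swap_mem_nonwanderingSet hp

/-- The hypotheses of the horseshoe theorem in terms of `W = max |·| |·|`. -/
lemma horseshoeParams_of_eq_max {W : ℝ} (hR1 : 1 ≤ R) (hR : A₀ = R ^ 2 - 2 * R) (hRc : R < c)
    (hW : W = max |(2 * R - A₁) / (2 * (c - R))| |(-2 * R - A₁) / (2 * (c - R))|)
    (hgap : R < A₀ - W ^ 2 - R) (hWR : W ≤ R) : HorseshoeParams A₀ A₁ c R W := by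
  have hpos : 0 < 2 * (c - R) := by linarith
  have h1 : |(2 * R - A₁) / (2 * (c - R))| ≤ W := hW ▸ le_max_left _ _
  have h2 : |(-2 * R - A₁) / (2 * (c - R))| ≤ W := hW ▸ le_max_right _ _
  refine ⟨by linarith, hR, hRc, (abs_nonneg _).trans h1, ?_, hWR, by linarith⟩
  rw [abs_div, abs_of_pos hpos, div_le_iff₀ hpos] at h1 h2
  rcases abs_cases A₁ with ⟨h3, -⟩ | ⟨h3, -⟩
  · linarith [neg_abs_le (-2 * R - A₁)]
  · linarith [le_abs_self (2 * R - A₁)]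

end CoupledHenonHyperbolic

theorem theorem3p2 (a₀ a₁ c A₀ A₁ R Wst Zst : ℝ) (hc : 0 < c)
    (hA₀ : A₀ = (a₀ + a₁) / 2) (hA₁ : A₁ = (a₀ - a₁) / 2) (hA : -1 ≤ A₀)
    (hR : R = 1 + √(1 + A₀))
    (hW : Wst = max |(2 * R - A₁) / (2 * (c - R))| |(-2 * R - A₁) / (2 * (c - R))|)
    (hZ : Zst = √(A₀ - Wst ^ 2 - 2 * R)) :
    nonwanderingSet (coupledHenon a₀ a₁ c) ⊆ boxVF R ∧
    (A₁ ≤ R → R < c → R < A₀ - Wst ^ 2 - R → Wst ≤ R →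
      HasBinaryHorseshoe (coupledHenon a₀ a₁ c) rotatedCoords (square R) (square R)) ∧
    (A₁ ≤ R → R < c → R < A₀ - Wst ^ 2 - R → Wst ≤ R → 4 + c ≤ Zst - Wst →
      IsUniformlyHyperbolic (coupledHenon a₀ a₁ c) (nonwanderingSet (coupledHenon a₀ a₁ c))) ∧
    (A₁ ≤ R → R < c → R < A₀ - Wst ^ 2 - R → Wst ≤ R → 4 ≤ Zst - Wst →
      IsUniformlyHyperbolic (coupledHenon a₀ a₁ c) (nonwanderingSet (coupledHenon a₀ a₁ c))) := by
  have hs : √(1 + A₀) ^ 2 = 1 + A₀ := Real.sq_sqrt (by linarith)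
  have hR1 : 1 ≤ R := by
    rw [hR]
    linarith [Real.sqrt_nonneg (1 + A₀)]
  have hRA : A₀ = R ^ 2 - 2 * R := by
    rw [hR]
    linarith
  refine ⟨nonwanderingSet_coupledHenon_subset hA₀ hR1 hRA, fun _ hRc hgap hWR => ?_,
    fun _ hRc hgap hWR hZW => ?_, fun _ hRc hgap hWR hZW => ?_⟩
  · exact hasBinaryHorseshoe_coupledHenon hA₀ hA₁ hR1
      (horseshoeParams_of_eq_max hR1 hRA hRc hW hgap hWR)
  · exact isUniformlyHyperbolic_coupledHenon hA₀ hA₁ hR1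
      (horseshoeParams_of_eq_max hR1 hRA hRc hW hgap hWR) hZ (by linarith)
  · exact isUniformlyHyperbolic_coupledHenon hA₀ hA₁ hR1
      (horseshoeParams_of_eq_max hR1 hRA hRc hW hgap hWR) hZ hZW
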